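/- Let $\Omega\subset\mathbb R$ be a non-empty bounded open interval with Lebesgue measure $\lambda$. For $t>1/2$ and $f\in L^2(\Omega)$ put $$\|f\|_{t,2}^2=\sum_{0\le\alpha\le\lfloor t\rfloor}\int_\Omega |f^{(\alpha)}|^2\,d\lambda+\mathbf 1_{\{t\notin\mathbb N\}}\int_\Omega\int_\Omega\frac{|f^{(\lfloor t\rfloor)}(x)-f^{(\lfloor t\rfloor)}(y)|^2}{|x-y|^{1+2(t-\lfloor t\rfloor)}}\,d\lambda(x)\,d\lambda(y),$$ where $f^{(\alpha)}$ are weak derivatives (and $\|f\|_{t,2}=\infty$ if one of those of order at most $\lfloor t\rfloor$ does not exist). Let $\mathsf W_2^t(\Omega)$ be the space of bounded continuous $f:\Omega\to\mathbb R$ with $\|f\|_{t,2}<\infty$, and let $$\mathcal P=\mathcal P(t,\zeta,D)=\Big\{p\in\mathsf W_2^t(\Omega):\int_\Omega p\,d\lambda=1,\ \inf_{\Omega}p\ge\zeta,\ \|p\|_{t,2}\le D\Big\},$$ where $t>1/2$, $D>0$ and $0\le\zeta<\lambda(\Omega)^{-1}<D^2$. Equip $\mathcal P$ with the metric of the sup-norm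 $\|\cdot\|_\Omega$ and its Borel $\sigma$-field. Let $\log 0=-\infty$. (a) Let $n\ge1$. For all $x_1,\dots,x_n\in\Omega$ there is exactly one $\hat p_n=\hat p_n(\cdot\,;x_1,\dots,x_n)\in\mathcal P$ with $$L_n(\hat p_n)=\sup_{p\in\mathcal P}L_n(p),\qquad L_n(p)=\frac1n\sum_{i=1}^n\log p(x_i)\in[-\infty,\infty).$$ The resulting map $\hat p_n:\Omega^n\to\mathcal P$ is measurable with respect to $\mathcal B(\Omega)^n$ and $\mathcal B(\mathcal P,\|\cdot\|_\Omega)$, and $\|\hat p_n\|_{t,2}=D$ always holds. (b) Let $\Theta\subset\mathbb R^m$ be non-empty and compact, $(V,\mathcal V)$ a measurable space, and $\rho:V\times\Theta\to\Omega$ a map such that $\rho(\cdot,\theta)$ is measurable for every $\theta\in\Theta$. Let $k\ge1$. For all $\theta\in\Theta$ and $v_1,\dots,v_k\in V$ there is exactly one $\tilde p_k(\theta)=\tilde p_k(\theta)(\cdot\,;v_1,\dots,v_k)\in\mathcal P$ with $$L_k(\theta,\tilde p_k(\theta))=\sup_{p\in\mathcal P}L_k(\theta,p),\qquad L_k(\theta,p)=\frac1k\sum_{i=1}^k\log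 p(\rho(v_i,\theta))\in[-\infty,\infty).$$ For every $\theta\in\Theta$ the resulting map $\tilde p_k(\theta):V^k\to\mathcal P$ is measurable with respect to $\mathcal V^k$ and $\mathcal B(\mathcal P,\|\cdot\|_\Omega)$, and $\|\tilde p_k(\theta)\|_{t,2}=D$ always holds. If moreover $\theta\mapsto\rho(v,\theta)$ is continuous on $\Theta$ for every $v\in V$, then for every fixed $v_1,\dots,v_k\in V$ the map $\theta\mapsto\tilde p_k(\theta)$ from $\Theta$ to $(\mathcal P,\|\cdot\|_\Omega)$ is continuous. -/

import Mathlib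

open scoped ENNReal ContDiff BoundedContinuousFunction

/-- Lebesgue measure on the (measurable) subset `Ω` of the real line. -/
noncomputable abbrev lebesgueOn (Ω : Set ℝ) : MeasureTheory.Measure Ω :=
  MeasureTheory.Measure.comap (Subtype.val : Ω → ℝ) MeasureTheory.volume

/-- `g` is a weak derivative of order `k` of `f` on the open set `Ω`: both functions are locally
integrable on `Ω`, and integration by parts holds against all smooth functions with compact support
in `Ω`. -/
def HasWeakDeriv (Ω : Set ℝ) (k : ℕ) (f g : Ω → ℝ) : Prop :=
  MeasureTheory.LocallyIntegrable f (lebesgueOn Ω) ∧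
  MeasureTheory.LocallyIntegrable g (lebesgueOn Ω) ∧
  ∀ φ : ℝ → ℝ, ContDiff ℝ ∞ φ → HasCompactSupport φ → tsupport φ ⊆ Ω →
    ∫ x : Ω, f x * iteratedDeriv k φ x ∂(lebesgueOn Ω) =
      (-1 : ℝ) ^ k * ∫ x : Ω, g x * φ x ∂(lebesgueOn Ω)

open Classical in
/-- The weak derivative of order `k` of `f` on `Ω` (some version of it; versions agree almost
everywhere), and `0` if there is none. -/
noncomputable def weakDeriv (Ω : Set ℝ) (k : ℕ) (f : Ω → ℝ) : Ω → ℝ :=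
  if h : ∃ g, HasWeakDeriv Ω k f g then h.choose else 0

open Classical in
/-- The square of the Sobolev norm of order `s ≥ 0` of `f`, as an element of `[0, ∞]`. It is `∞` if
one of the weak derivatives up to the order `⌊s⌋` does not exist. For a non-integer `s` it includes
the Slobodeckij double integral of the weak derivative of order `⌊s⌋`. -/
noncomputable def sobolevENormSq (Ω : Set ℝ) (s : ℝ) (f : Ω → ℝ) : ℝ≥0∞ :=
  if ∀ k ≤ ⌊s⌋₊, ∃ g, HasWeakDeriv Ω k f g then
    (∑ k ∈ Finset.range (⌊s⌋₊ + 1),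
      ∫⁻ x : Ω, ENNReal.ofReal (weakDeriv Ω k f x ^ 2) ∂(lebesgueOn Ω)) +
      if (⌊s⌋₊ : ℝ) = s then 0
      else ∫⁻ x : Ω, ∫⁻ y : Ω, ENNReal.ofReal
        ((weakDeriv Ω ⌊s⌋₊ f x - weakDeriv Ω ⌊s⌋₊ f y) ^ 2 /
          |(x : ℝ) - (y : ℝ)| ^ (1 + 2 * (s - (⌊s⌋₊ : ℝ)))) ∂(lebesgueOn Ω) ∂(lebesgueOn Ω)
  else ⊤

/-- The Sobolev norm of order `s ≥ 0` on `Ω`, with values in `[0, ∞]`. -/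
noncomputable def sobolevENorm (Ω : Set ℝ) (s : ℝ) (f : Ω → ℝ) : ℝ≥0∞ :=
  sobolevENormSq Ω s f ^ (1 / 2 : ℝ)

/-- The square integrable functions with finite Sobolev norm of order `s`. -/
def MemSobolev (Ω : Set ℝ) (s : ℝ) (f : Ω → ℝ) : Prop :=
  MeasureTheory.MemLp f 2 (lebesgueOn Ω) ∧ sobolevENorm Ω s f < ⊤

/-- The Sobolev space of order `s` (for `s > 1/2`), consisting of bounded continuous functions
on `Ω`. -/
def sobolevSpace (Ω : Set ℝ) (s : ℝ) : Set (Ω →ᵇ ℝ) :=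
  {f | MemSobolev Ω s f}

/-- The non-parametric model of probability densities in the Sobolev ball of radius `D` and order
`t` that are bounded below by `ζ`. As a subset of the bounded continuous functions, it carries the
sup-norm metric. -/
def densityModel (Ω : Set ℝ) (t ζ D : ℝ) : Set (Ω →ᵇ ℝ) :=
  {p | p ∈ sobolevSpace Ω t ∧ ∫ x : Ω, p x ∂(lebesgueOn Ω) = 1 ∧ (∀ x, ζ ≤ p x) ∧
    sobolevENorm Ω t p ≤ ENNReal.ofReal D}

/-- The normalized log-likelihood `n⁻¹ ∑ log p(x i)` of a non-negative function `p` at the data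
`x`, with values in the extended reals and `log 0 = -∞`. -/
noncomputable def logLik {Ω : Set ℝ} {n : ℕ} (p : Ω → ℝ) (x : Fin n → Ω) : EReal :=
  ((1 / (n : ℝ) : ℝ) : EReal) * ∑ i, ENNReal.log (ENNReal.ofReal (p (x i)))

/-- The normalized log-likelihood `k⁻¹ ∑ log p(ρ(v i, θ))` at the simulated data. -/
noncomputable def simLogLik {Ω : Set ℝ} {V T : Type*} {k : ℕ} (ρ : V → T → Ω) (θ : T)
    (p : Ω → ℝ) (v : Fin k → V) : EReal :=
  ((1 / (k : ℝ) : ℝ) : EReal) * ∑ i, ENNReal.log (ENNReal.ofReal (p (ρ (v i) θ)))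

open MeasureTheory Filter Topology

/-! Since the logarithm turns products into sums, maximizing the log-likelihood amounts to
maximizing the real number `∏ p(x i)`, which is continuous in `p` for the sup-norm and causes no
trouble when `p` vanishes at a data point. Everything then rests on compactness of the model and on
the Hilbertian character of the Sobolev norm.

Compactness (`isCompact_densityModel`) combines a common Hölder modulus on Sobolev balls of order
above `1/2`, closedness of these balls under uniform convergence (`isClosed_sobolevENormSq_le`) and
an Arzelà–Ascoli argument. A maximizer therefore exists. Its likelihood is positive because the
uniform density belongs to the model.

A maximizer has norm exactly `D` (`IsLikelihoodMax.sobolevENormSq_eq`): from inside the ball one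
could mix in a little of a density with high peaks at the data and gain likelihood. It is unique
(`IsLikelihoodMax.unique`): by the inequality of arithmetic and geometric means the midpoint of two
maximizers is again one, so all three have norm `D`, and the parallelogram identity makes the two
equal.

Finally `∏ p(x i)` is jointly continuous in `p` and the data, so on a compact model the unique
maximizer depends continuously on the data (`continuous_of_isLikelihoodMax`), hence measurably. The
simulated estimator is this map composed with `ρ`, which carries measurability in `v` and continuity
in `θ` over. -/

theorem lebesgueOn_univ {Ω : Set ℝ} (hΩ : MeasurableSet Ω) :
    lebesgueOn Ω Set.univ = volume Ω := by
  rw [comap_subtype_coe_apply hΩ, Set.image_univ, Subtype.range_coe]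

instance isFiniteMeasure_lebesgueOn_Ioo (a b : ℝ) :
    IsFiniteMeasure (lebesgueOn (Set.Ioo a b)) :=
  ⟨by rw [lebesgueOn_univ measurableSet_Ioo]; simp⟩

theorem measureReal_lebesgueOn_Ioo_univ {a b : ℝ} (hab : a < b) :
    (lebesgueOn (Set.Ioo a b)).real Set.univ = b - a := by
  rw [measureReal_def, lebesgueOn_univ measurableSet_Ioo, Real.volume_Ioo,
    ENNReal.toReal_ofReal (by linarith)]

/-! ### Weak derivatives -/

theorem hasCompactSupport_subtype {Ω : Set ℝ} {φ : ℝ → ℝ} (hφ : HasCompactSupport φ)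
    (hΩ : tsupport φ ⊆ Ω) : HasCompactSupport fun x : Ω => φ x := by
  have hK : IsCompact ((Subtype.val : Ω → ℝ) ⁻¹' tsupport φ) :=
    Topology.IsInducing.subtypeVal.isCompact_preimage' hφ (by simpa using hΩ)
  refine HasCompactSupport.intro hK fun x hx => ?_
  exact image_eq_zero_of_notMem_tsupport hx

theorem tsupport_iteratedDeriv_subset {φ : ℝ → ℝ} (k : ℕ) :
    tsupport (iteratedDeriv k φ) ⊆ tsupport φ := by
  induction k with
  | zero => simp
  | succ k ih =>
    rw [iteratedDeriv_succ]
    exact (closure_minimal support_deriv_subset (isClosed_tsupport _)).trans ih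

theorem hasCompactSupport_iteratedDeriv {φ : ℝ → ℝ} (hφ : HasCompactSupport φ) (k : ℕ) :
    HasCompactSupport (iteratedDeriv k φ) :=
  hφ.of_isClosed_subset (isClosed_tsupport _) (tsupport_iteratedDeriv_subset k)

theorem contDiff_iteratedDeriv {φ : ℝ → ℝ} (hφ : ContDiff ℝ ∞ φ) (k : ℕ) :
    ContDiff ℝ ∞ (iteratedDeriv k φ) := by
  rw [iteratedDeriv_eq_iterate]
  exact hφ.iterate_deriv k

theorem integrable_mul_test {Ω : Set ℝ} {f : Ω → ℝ} (hf : LocallyIntegrable f (lebesgueOn Ω))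
    {φ : ℝ → ℝ} (hφ : Continuous φ) (hc : HasCompactSupport φ) (hΩ : tsupport φ ⊆ Ω) :
    Integrable (fun x : Ω => f x * φ x) (lebesgueOn Ω) := by
  have := hf.integrable_smul_left_of_hasCompactSupport (g := fun x : Ω => φ x)
    (hφ.comp continuous_subtype_val) (hasCompactSupport_subtype hc hΩ)
  simpa [mul_comm] using this

theorem integrable_mul_iteratedDeriv_test {Ω : Set ℝ} {f : Ω → ℝ}
    (hf : LocallyIntegrable f (lebesgueOn Ω)) {φ : ℝ → ℝ} (hφ : ContDiff ℝ ∞ φ)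
    (hc : HasCompactSupport φ) (hΩ : tsupport φ ⊆ Ω) (k : ℕ) :
    Integrable (fun x : Ω => f x * iteratedDeriv k φ x) (lebesgueOn Ω) :=
  integrable_mul_test hf (contDiff_iteratedDeriv hφ k).continuous
    (hasCompactSupport_iteratedDeriv hc k) ((tsupport_iteratedDeriv_subset k).trans hΩ)

theorem HasWeakDeriv.linear_comb {Ω : Set ℝ} {k : ℕ} {f₁ f₂ g₁ g₂ : Ω → ℝ}
    (h₁ : HasWeakDeriv Ω k f₁ g₁) (h₂ : HasWeakDeriv Ω k f₂ g₂) (c d : ℝ) :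
    HasWeakDeriv Ω k (fun x => c * f₁ x + d * f₂ x) (fun x => c * g₁ x + d * g₂ x) := by
  refine ⟨(h₁.1.smul c).add (h₂.1.smul d), (h₁.2.1.smul c).add (h₂.2.1.smul d), ?_⟩
  intro φ hφ hc hΩ
  have e₁ := h₁.2.2 φ hφ hc hΩ
  have e₂ := h₂.2.2 φ hφ hc hΩ
  have i₁ := integrable_mul_iteratedDeriv_test h₁.1 hφ hc hΩ k
  have i₂ := integrable_mul_iteratedDeriv_test h₂.1 hφ hc hΩ k
  have j₁ := integrable_mul_test h₁.2.1 hφ.continuous hc hΩ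
  have j₂ := integrable_mul_test h₂.2.1 hφ.continuous hc hΩ
  have l : ∫ x : Ω, (c * f₁ x + d * f₂ x) * iteratedDeriv k φ x ∂(lebesgueOn Ω) =
      c * ∫ x : Ω, f₁ x * iteratedDeriv k φ x ∂(lebesgueOn Ω) +
      d * ∫ x : Ω, f₂ x * iteratedDeriv k φ x ∂(lebesgueOn Ω) := by
    rw [← integral_const_mul, ← integral_const_mul,
      ← integral_add (i₁.const_mul c) (i₂.const_mul d)]
    congr 1; ext x; ring
  have r : ∫ x : Ω, (c * g₁ x + d * g₂ x) * φ x ∂(lebesgueOn Ω) =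
      c * ∫ x : Ω, g₁ x * φ x ∂(lebesgueOn Ω) + d * ∫ x : Ω, g₂ x * φ x ∂(lebesgueOn Ω) := by
    rw [← integral_const_mul, ← integral_const_mul,
      ← integral_add (j₁.const_mul c) (j₂.const_mul d)]
    congr 1; ext x; ring
  rw [l, r, e₁, e₂]; ring

theorem ae_eq_zero_of_forall_integral_test {Ω : Set ℝ} (hΩ : IsOpen Ω) {f : Ω → ℝ}
    (hf : LocallyIntegrable f (lebesgueOn Ω))
    (h : ∀ φ : ℝ → ℝ, ContDiff ℝ ∞ φ → HasCompactSupport φ → tsupport φ ⊆ Ω →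
      ∫ x : Ω, f x * φ x ∂(lebesgueOn Ω) = 0) : f =ᵐ[lebesgueOn Ω] 0 := by
  -- Extension by zero to the line brings the fundamental lemma of the calculus of variations on
  -- open sets within reach.
  have hext : ∀ x : Ω, Function.extend Subtype.val f 0 (x : ℝ) = f x := fun x =>
    Subtype.val_injective.extend_apply f 0 x
  have hloc : LocallyIntegrableOn (Function.extend Subtype.val f 0) Ω volume := by
    rw [← locallyIntegrable_comap hΩ.measurableSet]
    simpa only [hext] using hf
  have key := hΩ.ae_eq_zero_of_integral_contDiff_smul_eq_zero hloc ?_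
  · have h2 : ∀ᵐ x ∂(volume.restrict Ω), Function.extend Subtype.val f 0 x = 0 :=
      (ae_restrict_iff' hΩ.measurableSet).2 key
    rw [← map_comap_subtype_coe hΩ.measurableSet] at h2
    have h3 := ae_of_ae_map measurable_subtype_coe.aemeasurable h2
    filter_upwards [h3] with x hx
    simpa [hext] using hx
  · intro φ hφ hc hs
    have h1 := h φ hφ hc hs
    have h2 : ∫ x : Ω, f x * φ x ∂(lebesgueOn Ω) =
        ∫ x in Ω, φ x • Function.extend Subtype.val f 0 x := by
      rw [← integral_subtype_comap hΩ.measurableSet]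
      congr 1; ext x; rw [hext, smul_eq_mul, mul_comm]
    rw [h2, setIntegral_eq_integral_of_forall_compl_eq_zero] at h1
    · exact h1
    · intro x hx
      rw [image_eq_zero_of_notMem_tsupport fun hx' => hx (hs hx'), zero_smul]

theorem HasWeakDeriv.ae_eq {Ω : Set ℝ} (hΩ : IsOpen Ω) {k : ℕ} {f g g' : Ω → ℝ}
    (h : HasWeakDeriv Ω k f g) (h' : HasWeakDeriv Ω k f g') : g =ᵐ[lebesgueOn Ω] g' := by
  have h0 := h.linear_comb h' 1 (-1)
  have := ae_eq_zero_of_forall_integral_test hΩ h0.2.1 fun φ hφ hc hs => ?_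
  · filter_upwards [this] with x hx
    have : 1 * g x + -1 * g' x = 0 := hx
    linarith
  · have e := h0.2.2 φ hφ hc hs
    simp only [one_mul, neg_mul, add_neg_cancel, zero_mul, integral_zero] at e
    have := mul_eq_zero.1 e.symm
    rcases this with h | h
    · exact absurd h (by positivity)
    · simpa using h

theorem hasWeakDeriv_zero {Ω : Set ℝ} {f : Ω → ℝ} (hf : LocallyIntegrable f (lebesgueOn Ω)) :
    HasWeakDeriv Ω 0 f f :=
  ⟨hf, hf, fun φ _ _ _ => by simp⟩

theorem HasWeakDeriv.weakDeriv {Ω : Set ℝ} {k : ℕ} {f g : Ω → ℝ}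
    (h : HasWeakDeriv Ω k f g) : HasWeakDeriv Ω k f (weakDeriv Ω k f) := by
  have h' : ∃ g, HasWeakDeriv Ω k f g := ⟨g, h⟩
  rw [_root_.weakDeriv, dif_pos h']
  exact h'.choose_spec

theorem HasWeakDeriv.weakDeriv_ae_eq {Ω : Set ℝ} (hΩ : IsOpen Ω) {k : ℕ} {f g : Ω → ℝ}
    (h : HasWeakDeriv Ω k f g) : _root_.weakDeriv Ω k f =ᵐ[lebesgueOn Ω] g :=
  h.weakDeriv.ae_eq hΩ h

/-! ### The Sobolev form of a family of functions -/

/-- The denominator in the Slobodeckij double integral of order `s`. -/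
noncomputable def slobodeckijWeight (Ω : Set ℝ) (s : ℝ) (z : Ω × Ω) : ℝ :=
  |(z.1 : ℝ) - (z.2 : ℝ)| ^ (1 + 2 * (s - (⌊s⌋₊ : ℝ)))

theorem slobodeckijWeight_nonneg (Ω : Set ℝ) (s : ℝ) (z : Ω × Ω) :
    0 ≤ slobodeckijWeight Ω s z := by
  unfold slobodeckijWeight; positivity

theorem measurable_slobodeckijWeight (Ω : Set ℝ) (s : ℝ) :
    Measurable (slobodeckijWeight Ω s) := by
  unfold slobodeckijWeight
  fun_prop

/-- The squared Sobolev norm, as a quadratic form in the family of the weak derivatives. -/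
noncomputable def sobolevForm (Ω : Set ℝ) (s : ℝ) (g : ℕ → Ω → ℝ) : ℝ≥0∞ :=
  (∑ k ∈ Finset.range (⌊s⌋₊ + 1), ∫⁻ x : Ω, ENNReal.ofReal (g k x ^ 2) ∂(lebesgueOn Ω)) +
    if (⌊s⌋₊ : ℝ) = s then 0
    else ∫⁻ z : Ω × Ω, ENNReal.ofReal ((g ⌊s⌋₊ z.1 - g ⌊s⌋₊ z.2) ^ 2 / slobodeckijWeight Ω s z)
      ∂((lebesgueOn Ω).prod (lebesgueOn Ω))

theorem sobolevForm_congr {Ω : Set ℝ} {s : ℝ} {g h : ℕ → Ω → ℝ}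
    (H : ∀ k ≤ ⌊s⌋₊, g k =ᵐ[lebesgueOn Ω] h k) : sobolevForm Ω s g = sobolevForm Ω s h := by
  unfold sobolevForm
  congr 1
  · refine Finset.sum_congr rfl fun k hk => lintegral_congr_ae ?_
    filter_upwards [H k (by simpa [Nat.lt_succ_iff] using hk)] with x hx
    rw [hx]
  · split_ifs
    · rfl
    · refine lintegral_congr_ae ?_
      have h1 := (Measure.quasiMeasurePreserving_fst (μ := lebesgueOn Ω)
        (ν := lebesgueOn Ω)).ae_eq_comp (H _ le_rfl)
      have h2 := (Measure.quasiMeasurePreserving_snd (μ := lebesgueOn Ω)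
        (ν := lebesgueOn Ω)).ae_eq_comp (H _ le_rfl)
      filter_upwards [h1, h2] with z hz1 hz2
      simp only [Function.comp] at hz1 hz2
      rw [hz1, hz2]

theorem aemeasurable_slobodeckij {Ω : Set ℝ} (s : ℝ) {g : Ω → ℝ}
    (hg : AEMeasurable g (lebesgueOn Ω)) :
    AEMeasurable (fun z : Ω × Ω =>
      ENNReal.ofReal ((g z.1 - g z.2) ^ 2 / slobodeckijWeight Ω s z))
      ((lebesgueOn Ω).prod (lebesgueOn Ω)) := by
  have h1 : AEMeasurable (fun z : Ω × Ω => g z.1) ((lebesgueOn Ω).prod (lebesgueOn Ω)) :=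
    hg.comp_quasiMeasurePreserving Measure.quasiMeasurePreserving_fst
  have h2 : AEMeasurable (fun z : Ω × Ω => g z.2) ((lebesgueOn Ω).prod (lebesgueOn Ω)) :=
    hg.comp_quasiMeasurePreserving Measure.quasiMeasurePreserving_snd
  exact (((h1.sub h2).pow_const 2).div
    (measurable_slobodeckijWeight Ω s).aemeasurable).ennreal_ofReal

theorem HasWeakDeriv.aemeasurable {Ω : Set ℝ} {k : ℕ} {f g : Ω → ℝ}
    (h : HasWeakDeriv Ω k f g) : AEMeasurable g (lebesgueOn Ω) :=
  h.2.1.aestronglyMeasurable.aemeasurable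

/-- Weak derivatives are unique almost everywhere, so any versions may replace the chosen ones.
Tonelli merges the iterated integral into one over the product measure, so that both kinds of terms
can be treated as weighted square integrals. -/
theorem sobolevENormSq_eq_sobolevForm {Ω : Set ℝ} [SFinite (lebesgueOn Ω)] (hΩ : IsOpen Ω) {s : ℝ} {f : Ω → ℝ}
    {g : ℕ → Ω → ℝ} (h : ∀ k ≤ ⌊s⌋₊, HasWeakDeriv Ω k f (g k)) :
    sobolevENormSq Ω s f = sobolevForm Ω s g := by
  rw [sobolevENormSq, if_pos fun k hk => ⟨_, h k hk⟩,
    ← sobolevForm_congr fun k hk => (h k hk).weakDeriv_ae_eq hΩ, sobolevForm]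
  congr 1
  split_ifs
  · rfl
  · rw [lintegral_prod _ (aemeasurable_slobodeckij s (h _ le_rfl).weakDeriv.aemeasurable)]
    rfl

theorem hasWeakDeriv_of_sobolevENormSq_ne_top {Ω : Set ℝ} {s : ℝ} {f : Ω → ℝ}
    (h : sobolevENormSq Ω s f ≠ ⊤) : ∀ k ≤ ⌊s⌋₊, HasWeakDeriv Ω k f (weakDeriv Ω k f) := by
  by_cases H : ∀ k ≤ ⌊s⌋₊, ∃ g, HasWeakDeriv Ω k f g
  · exact fun k hk => (H k hk).choose_spec.weakDeriv
  · rw [sobolevENormSq, if_neg H] at h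
    exact absurd rfl h

/-- Pointwise, `(cu + dv)² + cd(u - v)² = cu² + dv²` when `c + d = 1`. All terms are added rather
than subtracted because the values lie in `[0, ∞]`. The weight is `1` for the derivative terms and
the Slobodeckij denominator for the double integral. -/
theorem lintegral_sq_convex_identity {X : Type*} [MeasurableSpace X] {μ : Measure X}
    {u v w : X → ℝ} (hu : AEMeasurable u μ) (hv : AEMeasurable v μ) (hw : AEMeasurable w μ)
    (hw0 : ∀ x, 0 ≤ w x) {c d : ℝ} (hc : 0 ≤ c) (hd : 0 ≤ d) (hcd : c + d = 1) :
    ∫⁻ x, ENNReal.ofReal ((c * u x + d * v x) ^ 2 / w x) ∂μ +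
      ENNReal.ofReal (c * d) * ∫⁻ x, ENNReal.ofReal ((u x - v x) ^ 2 / w x) ∂μ =
    ENNReal.ofReal c * ∫⁻ x, ENNReal.ofReal (u x ^ 2 / w x) ∂μ +
      ENNReal.ofReal d * ∫⁻ x, ENNReal.ofReal (v x ^ 2 / w x) ∂μ := by
  have m1 : AEMeasurable (fun x => ENNReal.ofReal ((c * u x + d * v x) ^ 2 / w x)) μ := by
    fun_prop
  have m2 : AEMeasurable (fun x => ENNReal.ofReal (u x ^ 2 / w x)) μ := by fun_prop
  have m3 : AEMeasurable (fun x => ENNReal.ofReal c * ENNReal.ofReal (u x ^ 2 / w x)) μ := by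
    fun_prop
  rw [← lintegral_const_mul' _ _ ENNReal.ofReal_ne_top,
    ← lintegral_const_mul' _ _ ENNReal.ofReal_ne_top,
    ← lintegral_const_mul' _ _ ENNReal.ofReal_ne_top, ← lintegral_add_left' m1,
    ← lintegral_add_left' m3]
  congr 1; ext x
  have := hw0 x
  rw [← ENNReal.ofReal_mul (by positivity), ← ENNReal.ofReal_mul hc, ← ENNReal.ofReal_mul hd,
    ← ENNReal.ofReal_add (by positivity) (by positivity),
    ← ENNReal.ofReal_add (by positivity) (by positivity)]
  congr 1
  obtain rfl : d = 1 - c := by linarith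
  ring

theorem sobolevForm_convex_identity {Ω : Set ℝ} {s : ℝ} {g h : ℕ → Ω → ℝ}
    (hg : ∀ k ≤ ⌊s⌋₊, AEMeasurable (g k) (lebesgueOn Ω))
    (hh : ∀ k ≤ ⌊s⌋₊, AEMeasurable (h k) (lebesgueOn Ω))
    {c d : ℝ} (hc : 0 ≤ c) (hd : 0 ≤ d) (hcd : c + d = 1) :
    sobolevForm Ω s (fun k x => c * g k x + d * h k x) +
      ENNReal.ofReal (c * d) * sobolevForm Ω s (fun k x => g k x - h k x) =
    ENNReal.ofReal c * sobolevForm Ω s g + ENNReal.ofReal d * sobolevForm Ω s h := by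
  unfold sobolevForm
  have e1 : ∀ k ∈ Finset.range (⌊s⌋₊ + 1), _ := fun k hk =>
    lintegral_sq_convex_identity (w := fun _ => 1)
      (hg k (by simpa [Nat.lt_succ_iff] using hk)) (hh k (by simpa [Nat.lt_succ_iff] using hk))
      aemeasurable_const (fun _ => zero_le_one) hc hd hcd
  simp only [div_one] at e1
  have e2 := lintegral_sq_convex_identity (μ := (lebesgueOn Ω).prod (lebesgueOn Ω))
    (u := fun z => g ⌊s⌋₊ z.1 - g ⌊s⌋₊ z.2) (v := fun z => h ⌊s⌋₊ z.1 - h ⌊s⌋₊ z.2)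
    (((hg _ le_rfl).comp_quasiMeasurePreserving Measure.quasiMeasurePreserving_fst).sub
      ((hg _ le_rfl).comp_quasiMeasurePreserving Measure.quasiMeasurePreserving_snd))
    (((hh _ le_rfl).comp_quasiMeasurePreserving Measure.quasiMeasurePreserving_fst).sub
      ((hh _ le_rfl).comp_quasiMeasurePreserving Measure.quasiMeasurePreserving_snd))
    (measurable_slobodeckijWeight Ω s).aemeasurable (slobodeckijWeight_nonneg Ω s) hc hd hcd
  have e3 := Finset.sum_congr rfl e1
  simp only [Finset.sum_add_distrib, ← Finset.mul_sum] at e3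
  by_cases hs : (⌊s⌋₊ : ℝ) = s
  · simp only [if_pos hs, add_zero]
    exact e3
  · simp only [if_neg hs, mul_add]
    have r1 : ∀ z : Ω × Ω, c * g ⌊s⌋₊ z.1 + d * h ⌊s⌋₊ z.1 - (c * g ⌊s⌋₊ z.2 + d * h ⌊s⌋₊ z.2)
        = c * (g ⌊s⌋₊ z.1 - g ⌊s⌋₊ z.2) + d * (h ⌊s⌋₊ z.1 - h ⌊s⌋₊ z.2) := fun z => by ring
    have r2 : ∀ z : Ω × Ω, g ⌊s⌋₊ z.1 - h ⌊s⌋₊ z.1 - (g ⌊s⌋₊ z.2 - h ⌊s⌋₊ z.2)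
        = (g ⌊s⌋₊ z.1 - g ⌊s⌋₊ z.2) - (h ⌊s⌋₊ z.1 - h ⌊s⌋₊ z.2) := fun z => by ring
    simp only [r1, r2]
    rw [add_add_add_comm, e3, e2, add_add_add_comm]

/-- The parallelogram identity for the squared Sobolev norm, with general weights. -/
theorem sobolevENormSq_convex_identity {Ω : Set ℝ} [SFinite (lebesgueOn Ω)] (hΩ : IsOpen Ω) {s : ℝ} {f h : Ω → ℝ}
    (hf : sobolevENormSq Ω s f ≠ ⊤) (hh : sobolevENormSq Ω s h ≠ ⊤)
    {c d : ℝ} (hc : 0 ≤ c) (hd : 0 ≤ d) (hcd : c + d = 1) :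
    sobolevENormSq Ω s (fun x => c * f x + d * h x) +
      ENNReal.ofReal (c * d) * sobolevENormSq Ω s (fun x => f x - h x) =
    ENNReal.ofReal c * sobolevENormSq Ω s f + ENNReal.ofReal d * sobolevENormSq Ω s h := by
  have wf := hasWeakDeriv_of_sobolevENormSq_ne_top hf
  have wh := hasWeakDeriv_of_sobolevENormSq_ne_top hh
  have ws : ∀ k ≤ ⌊s⌋₊, HasWeakDeriv Ω k (fun x => f x - h x)
      (fun x => weakDeriv Ω k f x - weakDeriv Ω k h x) := fun k hk => by
    simpa [sub_eq_add_neg] using (wf k hk).linear_comb (wh k hk) 1 (-1)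
  rw [sobolevENormSq_eq_sobolevForm hΩ wf, sobolevENormSq_eq_sobolevForm hΩ wh,
    sobolevENormSq_eq_sobolevForm hΩ ws,
    sobolevENormSq_eq_sobolevForm hΩ fun k hk => (wf k hk).linear_comb (wh k hk) c d]
  exact sobolevForm_convex_identity (fun k hk => (wf k hk).aemeasurable)
    (fun k hk => (wh k hk).aemeasurable) hc hd hcd

theorem lintegral_sq_le_sobolevForm {Ω : Set ℝ} {s : ℝ} (g : ℕ → Ω → ℝ) {k : ℕ}
    (hk : k ≤ ⌊s⌋₊) :
    ∫⁻ x : Ω, ENNReal.ofReal (g k x ^ 2) ∂(lebesgueOn Ω) ≤ sobolevForm Ω s g :=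
  (Finset.single_le_sum
    (f := fun k => ∫⁻ x : Ω, ENNReal.ofReal (g k x ^ 2) ∂(lebesgueOn Ω))
    (fun _ _ => zero_le) (Finset.mem_range.2 (Nat.lt_succ_of_le hk))).trans
    le_self_add

theorem sobolevENorm_le_ofReal_iff {Ω : Set ℝ} {s D : ℝ} (hD : 0 ≤ D) {f : Ω → ℝ} :
    sobolevENorm Ω s f ≤ ENNReal.ofReal D ↔ sobolevENormSq Ω s f ≤ ENNReal.ofReal (D ^ 2) := by
  rw [sobolevENorm, one_div, ENNReal.rpow_inv_le_iff two_pos, ENNReal.ofReal_rpow_of_nonneg hD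
    two_pos.le, Real.rpow_two]

theorem sobolevENorm_lt_ofReal_iff {Ω : Set ℝ} {s D : ℝ} (hD : 0 ≤ D) {f : Ω → ℝ} :
    sobolevENorm Ω s f < ENNReal.ofReal D ↔ sobolevENormSq Ω s f < ENNReal.ofReal (D ^ 2) := by
  rw [sobolevENorm, one_div, ENNReal.rpow_inv_lt_iff two_pos, ENNReal.ofReal_rpow_of_nonneg hD
    two_pos.le, Real.rpow_two]

/-! ### Smooth functions -/

theorem integral_mul_iteratedDeriv_eq {G φ : ℝ → ℝ} (hG : ContDiff ℝ ∞ G) (hφ : ContDiff ℝ ∞ φ)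
    (hc : HasCompactSupport φ) (k : ℕ) :
    ∫ x, G x * iteratedDeriv k φ x = (-1) ^ k * ∫ x, iteratedDeriv k G x * φ x := by
  induction k generalizing G with
  | zero => simp
  | succ k ih =>
    have hG' : ContDiff ℝ ∞ (deriv G) := (contDiff_infty_iff_deriv.1 hG).2
    have hk := contDiff_iteratedDeriv hφ k
    have hk' : ContDiff ℝ ∞ (deriv (iteratedDeriv k φ)) := (contDiff_infty_iff_deriv.1 hk).2
    have ck := hasCompactSupport_iteratedDeriv hc k
    have := integral_mul_deriv_eq_deriv_mul_of_integrable (u := G) (v := iteratedDeriv k φ)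
      (u' := deriv G) (v' := deriv (iteratedDeriv k φ))
      (fun x _ => (hG.differentiable (by simp) x).hasDerivAt)
      (fun x _ => (hk.differentiable (by simp) x).hasDerivAt)
      ((hG.continuous.mul hk'.continuous).integrable_of_hasCompactSupport ck.deriv.mul_left)
      ((hG'.continuous.mul hk.continuous).integrable_of_hasCompactSupport ck.mul_left)
      ((hG.continuous.mul hk.continuous).integrable_of_hasCompactSupport ck.mul_left)
    simp only [iteratedDeriv_succ (f := φ)]
    rw [this, ih hG']
    simp only [iteratedDeriv_succ' (f := G)]
    ring

theorem locallyIntegrable_restrict_of_continuous {Ω : Set ℝ} (hΩ : MeasurableSet Ω) {G : ℝ → ℝ}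
    (hG : Continuous G) : LocallyIntegrable (fun x : Ω => G x) (lebesgueOn Ω) :=
  (locallyIntegrable_comap hΩ).2 (hG.locallyIntegrable.locallyIntegrableOn Ω)

theorem integral_mul_test_eq {Ω : Set ℝ} (hΩ : MeasurableSet Ω) (G : ℝ → ℝ) {φ : ℝ → ℝ}
    (hs : tsupport φ ⊆ Ω) : ∫ x : Ω, G x * φ x ∂(lebesgueOn Ω) = ∫ x, G x * φ x := by
  rw [integral_subtype_comap hΩ (fun x => G x * φ x),
    setIntegral_eq_integral_of_forall_compl_eq_zero]
  intro x hx
  rw [image_eq_zero_of_notMem_tsupport fun hx' => hx (hs hx'), mul_zero]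

theorem hasWeakDeriv_of_contDiff {Ω : Set ℝ} (hΩ : MeasurableSet Ω) {G : ℝ → ℝ}
    (hG : ContDiff ℝ ∞ G) (k : ℕ) :
    HasWeakDeriv Ω k (fun x => G x) (fun x => iteratedDeriv k G x) := by
  refine ⟨locallyIntegrable_restrict_of_continuous hΩ hG.continuous,
    locallyIntegrable_restrict_of_continuous hΩ (contDiff_iteratedDeriv hG k).continuous, ?_⟩
  intro φ hφ hc hs
  rw [integral_mul_test_eq hΩ G ((tsupport_iteratedDeriv_subset k).trans hs),
    integral_mul_test_eq hΩ _ hs, integral_mul_iteratedDeriv_eq hG hφ hc]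

theorem integrableOn_abs_rpow {c : ℝ} (hc : -1 < c) {r : ℝ} (hr : 0 ≤ r) :
    IntegrableOn (fun u : ℝ => |u| ^ c) (Set.Ioc (-r) r) := by
  have h1 : IntervalIntegrable (fun u : ℝ => |u| ^ c) volume 0 r := by
    refine (intervalIntegral.intervalIntegrable_rpow' hc).congr_ae ?_
    rw [Set.uIoc_of_le hr]
    refine (ae_restrict_iff' measurableSet_Ioc).2 (Eventually.of_forall fun u hu => ?_)
    simp only [abs_of_pos hu.1]
  have h2 : IntervalIntegrable (fun u : ℝ => |u| ^ c) volume (-r) 0 := by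
    have := ((IntervalIntegrable.iff_comp_neg (by simp)).1 h1).symm
    simpa using this
  have := h2.trans h1
  rwa [intervalIntegrable_iff_integrableOn_Ioc_of_le (by linarith)] at this

theorem lintegral_abs_sub_rpow_lt_top (a b : ℝ) {c : ℝ} (hc : -1 < c) :
    ∫⁻ z : Set.Ioo a b × Set.Ioo a b, ENNReal.ofReal (|(z.1 : ℝ) - z.2| ^ c)
      ∂((lebesgueOn (Set.Ioo a b)).prod (lebesgueOn (Set.Ioo a b))) < ⊤ := by
  set r := max (b - a) 0
  have hr : 0 ≤ r := le_max_right _ _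
  set K := ∫⁻ u in Set.Ioc (-r) r, ENNReal.ofReal (|u| ^ c)
  have hK : K < ⊤ := by
    have := (integrableOn_abs_rpow hc hr).2
    rw [HasFiniteIntegral] at this
    refine lt_of_le_of_lt (lintegral_mono fun u => ?_) this
    rw [Real.enorm_eq_ofReal_abs]
    exact ENNReal.ofReal_le_ofReal (le_abs_self _)
  rw [lintegral_prod _ (Measurable.aemeasurable (by fun_prop))]
  have hx : ∀ x : Set.Ioo a b, ∫⁻ y : Set.Ioo a b, ENNReal.ofReal (|(x : ℝ) - y| ^ c)
      ∂(lebesgueOn (Set.Ioo a b)) ≤ K := by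
    intro x
    rw [lintegral_subtype_comap measurableSet_Ioo fun y : ℝ => ENNReal.ofReal (|(x : ℝ) - y| ^ c),
      ← lintegral_indicator measurableSet_Ioo]
    simp only [K]
    rw [← lintegral_indicator measurableSet_Ioc, 
      ← lintegral_sub_left_eq_self ((Set.Ioc (-r) r).indicator _) (x : ℝ)]
    refine lintegral_mono fun y => ?_
    by_cases hy : y ∈ Set.Ioo a b
    · have : (x : ℝ) - y ∈ Set.Ioc (-r) r := by
        have h1 := x.2.1; have h2 := x.2.2
        have h3 : b - a ≤ r := le_max_left _ _
        exact ⟨by linarith [hy.1, hy.2], by linarith [hy.1, hy.2]⟩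
      rw [Set.indicator_of_mem hy, Set.indicator_of_mem this]
    · rw [Set.indicator_of_notMem hy]; exact zero_le
  calc _ ≤ ∫⁻ _ : Set.Ioo a b, K ∂(lebesgueOn (Set.Ioo a b)) := lintegral_mono hx
    _ < ⊤ := by
      rw [lintegral_const]
      exact ENNReal.mul_lt_top hK (measure_lt_top _ _)

/-- All derivatives of `G` are bounded on `[a, b]`. The derivative of order `⌊s⌋₊` is Lipschitz
there, so the Slobodeckij integrand is at most a constant times `|x - y|` to the power `1 - 2(s -
⌊s⌋₊) > -1`, which is integrable. -/
theorem sobolevENormSq_lt_top_of_contDiff {a b s : ℝ} {G : ℝ → ℝ}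
    (hG : ContDiff ℝ ∞ G) : sobolevENormSq (Set.Ioo a b) s (fun x => G x) < ⊤ := by
  rw [sobolevENormSq_eq_sobolevForm isOpen_Ioo
    fun k _ => hasWeakDeriv_of_contDiff measurableSet_Ioo hG k]
  have bdd : ∀ k, ∃ C, 0 ≤ C ∧ ∀ x ∈ Set.Icc a b, |iteratedDeriv k G x| ≤ C := by
    intro k
    obtain ⟨C, hC⟩ := isCompact_Icc.exists_bound_of_continuousOn (s := Set.Icc a b)
      (contDiff_iteratedDeriv hG k).continuous.continuousOn
    exact ⟨max C 0, le_max_right _ _, fun x hx => (hC x hx).trans (le_max_left _ _)⟩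
  refine ENNReal.add_lt_top.2 ⟨?_, ?_⟩
  · refine ENNReal.sum_lt_top.2 fun k _ => ?_
    obtain ⟨C, hC0, hC⟩ := bdd k
    calc _ ≤ ∫⁻ _ : Set.Ioo a b, ENNReal.ofReal (C ^ 2) ∂(lebesgueOn (Set.Ioo a b)) := by
          refine lintegral_mono fun x => ENNReal.ofReal_le_ofReal ?_
          exact sq_le_sq' (neg_le_of_abs_le (hC x (Set.Ioo_subset_Icc_self x.2)))
            (le_of_abs_le (hC x (Set.Ioo_subset_Icc_self x.2)))
      _ < ⊤ := by
          rw [lintegral_const]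
          exact ENNReal.mul_lt_top ENNReal.ofReal_lt_top (measure_lt_top _ _)
  · split_ifs with h
    · exact ENNReal.zero_lt_top
    · obtain ⟨L, hL0, hL⟩ := bdd (⌊s⌋₊ + 1)
      have hσ1 : s - ⌊s⌋₊ < 1 := by linarith [Nat.lt_floor_add_one s]
      have lip : ∀ x ∈ Set.Icc a b, ∀ y ∈ Set.Icc a b,
          |iteratedDeriv ⌊s⌋₊ G x - iteratedDeriv ⌊s⌋₊ G y| ≤ L * |x - y| := by
        intro x hx y hy
        refine Convex.norm_image_sub_le_of_norm_deriv_le (s := Set.Icc a b)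
          (fun z _ => (contDiff_iteratedDeriv hG ⌊s⌋₊).differentiable (by simp) z)
          (fun z hz => ?_) (convex_Icc a b) hy hx
        rw [← iteratedDeriv_succ]
        exact hL z hz
      calc _ ≤ ∫⁻ z : Set.Ioo a b × Set.Ioo a b, ENNReal.ofReal (L ^ 2) *
            ENNReal.ofReal (|(z.1 : ℝ) - z.2| ^ (1 - 2 * (s - ⌊s⌋₊)))
            ∂((lebesgueOn (Set.Ioo a b)).prod (lebesgueOn (Set.Ioo a b))) := by
            refine lintegral_mono fun z => ?_
            rw [← ENNReal.ofReal_mul (by positivity)]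
            refine ENNReal.ofReal_le_ofReal ?_
            unfold slobodeckijWeight
            have hz := lip z.1 (Set.Ioo_subset_Icc_self z.1.2) z.2 (Set.Ioo_subset_Icc_self z.2.2)
            rcases eq_or_ne (z.1 : ℝ) z.2 with he | hne
            · simp only [he, sub_self]
              have : (0 : ℝ) ≤ |0| ^ (1 - 2 * (s - ⌊s⌋₊)) := by positivity
              simp only [ne_eq, OfNat.ofNat_ne_zero, not_false_eq_true, zero_pow, zero_div]
              positivity
            · have hpos : 0 < |(z.1 : ℝ) - z.2| := abs_pos.2 (sub_ne_zero.2 hne)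
              rw [div_le_iff₀ (Real.rpow_pos_of_pos hpos _), mul_assoc, ← Real.rpow_add hpos,
                show (1 - 2 * (s - ⌊s⌋₊) + (1 + 2 * (s - (⌊s⌋₊ : ℝ)))) = 2 by ring, Real.rpow_two,
                ← mul_pow, ← sq_abs (_ - _)]
              gcongr
        _ < ⊤ := by
            rw [lintegral_const_mul' _ _ ENNReal.ofReal_ne_top]
            exact ENNReal.mul_lt_top ENNReal.ofReal_lt_top
              (lintegral_abs_sub_rpow_lt_top a b (by linarith))

theorem sobolevENormSq_const (a b s c : ℝ) :
    sobolevENormSq (Set.Ioo a b) s (fun _ => c) = ENNReal.ofReal (c ^ 2 * (b - a)) := by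
  rw [sobolevENormSq_eq_sobolevForm isOpen_Ioo
    fun k _ => hasWeakDeriv_of_contDiff (G := fun _ => c) measurableSet_Ioo contDiff_const k,
    sobolevForm, Finset.sum_range_succ']
  simp [iteratedDeriv_const, lebesgueOn_univ, ENNReal.ofReal_mul, sq_nonneg]

/-! ### Hölder estimates -/

theorem integrable_of_lintegral_ofReal_le {X : Type*} [MeasurableSpace X] {μ : Measure X}
    {K : X → ℝ} (hK : AEStronglyMeasurable K μ) (h0 : ∀ x, 0 ≤ K x) {E : ℝ} (hE : 0 ≤ E)
    (h : ∫⁻ x, ENNReal.ofReal (K x) ∂μ ≤ ENNReal.ofReal E) :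
    Integrable K μ ∧ ∫ x, K x ∂μ ≤ E := by
  have hi : Integrable K μ :=
    (lintegral_ofReal_ne_top_iff_integrable hK (Eventually.of_forall h0)).1
      (ne_top_of_le_ne_top ENNReal.ofReal_ne_top h)
  refine ⟨hi, ?_⟩
  rw [← ofReal_integral_eq_lintegral_ofReal hi (Eventually.of_forall h0)] at h
  exact (ENNReal.ofReal_le_ofReal_iff hE).1 h

/-- The test function is the difference of the distribution functions of two mollifiers, one at `x`
and one at `y`: a plateau that rises near `x` and falls near `y`. Testing a weak derivative against
it compares local averages of the function at the two points. -/
theorem exists_contDiff_deriv_eq_sub {x y r : ℝ} (hxy : x < y) (hr : 0 < r) :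
    ∃ ψ₁ ψ₂ φ : ℝ → ℝ, ContDiff ℝ ∞ φ ∧ HasCompactSupport φ ∧ tsupport φ ⊆ Set.Icc (x - r) (y + r) ∧
      (∀ z, |φ z| ≤ 1) ∧ (∀ z, deriv φ z = ψ₁ z - ψ₂ z) ∧
      (∀ z, 0 ≤ ψ₁ z) ∧ (∀ z, 0 ≤ ψ₂ z) ∧ Continuous ψ₁ ∧ Continuous ψ₂ ∧
      tsupport ψ₁ ⊆ Metric.closedBall x r ∧ tsupport ψ₂ ⊆ Metric.closedBall y r ∧
      ∫ z, ψ₁ z = 1 ∧ ∫ z, ψ₂ z = 1 := by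
  let B₁ : ContDiffBump x := ⟨r / 2, r, by positivity, by linarith⟩
  let B₂ : ContDiffBump y := ⟨r / 2, r, by positivity, by linarith⟩
  have key : ∀ (c : ℝ) (B : ContDiffBump c), B.rOut = r →
      ContDiff ℝ ∞ (B.normed volume) ∧
      tsupport (B.normed volume) ⊆ Metric.closedBall c r ∧
      (∀ z ≤ c - r, ∫ u in Set.Iic z, B.normed volume u = 0) ∧
      (∀ z, c + r ≤ z → ∫ u in Set.Iic z, B.normed volume u = 1) ∧
      (∀ z, 0 ≤ ∫ u in Set.Iic z, B.normed volume u) ∧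
      (∀ z, ∫ u in Set.Iic z, B.normed volume u ≤ 1) ∧
      (∀ z, HasDerivAt (fun z => ∫ u in Set.Iic z, B.normed volume u) (B.normed volume z) z) := by
    intro c B hB
    have hcd : ContDiff ℝ ∞ (B.normed volume) := B.contDiff_normed
    have hint : Integrable (B.normed volume) :=
      hcd.continuous.integrable_of_hasCompactSupport B.hasCompactSupport_normed
    have hz : ∀ u, r ≤ |u - c| → B.normed volume u = 0 := by
      intro u hu
      by_contra h
      have : u ∈ Function.support (B.normed volume) := h
      rw [B.support_normed_eq, hB, Metric.mem_ball, Real.dist_eq] at this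
      linarith
    refine ⟨hcd, by rw [B.tsupport_normed_eq, hB], ?_, ?_, ?_, ?_, ?_⟩
    · intro z hzc
      refine setIntegral_eq_zero_of_forall_eq_zero fun u hu => hz u ?_
      have : u ≤ z := hu
      rw [abs_of_nonpos (by linarith)]; linarith
    · intro z hzc
      rw [setIntegral_eq_integral_of_forall_compl_eq_zero, B.integral_normed]
      intro u hu
      have : z < u := not_le.1 hu
      refine hz u ?_
      rw [abs_of_nonneg (by linarith)]; linarith
    · exact fun z => integral_nonneg fun u => B.nonneg_normed u
    · intro z
      rw [← B.integral_normed (μ := volume)]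
      exact setIntegral_le_integral hint (Eventually.of_forall fun u => B.nonneg_normed u)
    · intro z
      have h1 : (fun z => ∫ u in Set.Iic z, B.normed volume u) =
          fun z => (∫ u in Set.Iic 0, B.normed volume u) + ∫ u in (0 : ℝ)..z, B.normed volume u := by
        ext z
        rw [← intervalIntegral.integral_Iic_sub_Iic hint.integrableOn hint.integrableOn]
        ring
      rw [h1]
      exact (intervalIntegral.integral_hasDerivAt_right hint.intervalIntegrable
        (hcd.continuous.stronglyMeasurableAtFilter _ _) hcd.continuous.continuousAt).const_add _
  obtain ⟨c1, t1, z1, o1, n1, l1, d1⟩ := key x B₁ rfl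
  obtain ⟨c2, t2, z2, o2, n2, l2, d2⟩ := key y B₂ rfl
  set ψ₁ := B₁.normed volume with hψ₁
  set ψ₂ := B₂.normed volume with hψ₂
  set φ : ℝ → ℝ := fun z => (∫ u in Set.Iic z, ψ₁ u) - ∫ u in Set.Iic z, ψ₂ u with hφ
  have hd : ∀ z, HasDerivAt φ (ψ₁ z - ψ₂ z) z := fun z => (d1 z).sub (d2 z)
  have hderiv : deriv φ = fun z => ψ₁ z - ψ₂ z := funext fun z => (hd z).deriv
  have hsupp : tsupport φ ⊆ Set.Icc (x - r) (y + r) := by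
    refine closure_minimal (fun z hz => ?_) isClosed_Icc
    by_contra hout
    rw [Set.mem_Icc, not_and_or, not_le, not_le] at hout
    refine hz ?_
    rcases hout with h | h
    · simp only [hφ, z1 z h.le, z2 z (by linarith), sub_zero]
    · simp only [hφ, o1 z (by linarith), o2 z h.le, sub_self]
  refine ⟨ψ₁, ψ₂, φ, ?_, isCompact_Icc.of_isClosed_subset (isClosed_tsupport _) hsupp, hsupp,
    fun z => ?_, fun z => (hd z).deriv, fun z => B₁.nonneg_normed z, fun z => B₂.nonneg_normed z,
    c1.continuous, c2.continuous, t1, t2, B₁.integral_normed, B₂.integral_normed⟩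
  · rw [contDiff_infty_iff_deriv, hderiv]
    exact ⟨fun z => (hd z).differentiableAt, c1.sub c2⟩
  · rw [abs_le]
    constructor <;> simp only [hφ] <;> linarith [n1 z, n2 z, l1 z, l2 z]

theorem abs_integral_mul_sub_le {Ω : Set ℝ} (hΩ : MeasurableSet Ω) {f : Ω → ℝ}
    (hf : LocallyIntegrable f (lebesgueOn Ω)) (x : Ω) {r ε : ℝ}
    (hε : ∀ y : Ω, |(y : ℝ) - x| ≤ r → |f y - f x| ≤ ε) {ψ : ℝ → ℝ} (hψ : Continuous ψ)
    (h0 : ∀ z, 0 ≤ ψ z) (hs : tsupport ψ ⊆ Metric.closedBall (x : ℝ) r) (hs' : tsupport ψ ⊆ Ω)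
    (h1 : ∫ z, ψ z = 1) : |∫ z : Ω, f z * ψ z ∂(lebesgueOn Ω) - f x| ≤ ε := by
  have hc : HasCompactSupport ψ :=
    (isCompact_closedBall _ _).of_isClosed_subset (isClosed_tsupport _) hs
  have hone : ∫ z : Ω, ψ z ∂(lebesgueOn Ω) = 1 := by
    have := integral_mul_test_eq hΩ (fun _ => 1) hs'
    simpa [h1] using this
  -- The integral of a non-integrable function is `0` by convention, so the value `1` already proves
  -- integrability.
  have hint : Integrable (fun z : Ω => ψ z) (lebesgueOn Ω) := by
    by_contra h
    rw [integral_undef h] at hone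
    exact zero_ne_one hone
  have e : ∫ z : Ω, f z * ψ z ∂(lebesgueOn Ω) - f x =
      ∫ z : Ω, (f z - f x) * ψ z ∂(lebesgueOn Ω) := by
    simp only [sub_mul]
    rw [integral_sub (integrable_mul_test hf hψ hc hs') (hint.const_mul _), integral_const_mul,
      hone, mul_one]
  rw [e, ← Real.norm_eq_abs]
  calc _ ≤ ∫ z : Ω, ε * ψ z ∂(lebesgueOn Ω) := by
        refine norm_integral_le_of_norm_le (hint.const_mul _) (Eventually.of_forall fun z => ?_)
        rw [norm_mul, Real.norm_eq_abs, Real.norm_eq_abs, abs_of_nonneg (h0 _)]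
        by_cases hz : (z : ℝ) ∈ tsupport ψ
        · have := hs hz
          rw [Metric.mem_closedBall, Real.dist_eq] at this
          exact mul_le_mul_of_nonneg_right (hε z this) (h0 _)
        · rw [image_eq_zero_of_notMem_tsupport hz]; simp
    _ = ε := by rw [integral_const_mul, hone, mul_one]

/-- The plateau function gives `f x - f y` as an integral of `g` over roughly `[x, y]`, up to errors
that vanish with `ε`. The square integral of `g` then yields the modulus `√(y - x)`. -/
theorem abs_sub_le_of_hasWeakDeriv_one {a b : ℝ} {f g : Set.Ioo a b → ℝ} (hf : Continuous f)
    (h : HasWeakDeriv (Set.Ioo a b) 1 f g) {D : ℝ}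
    (hg : ∫⁻ x, ENNReal.ofReal (g x ^ 2) ∂(lebesgueOn (Set.Ioo a b)) ≤ ENNReal.ofReal (D ^ 2))
    {x y : Set.Ioo a b} (hxy : (x : ℝ) < y) :
    |f x - f y| ≤ (D ^ 2 + 1) / 2 * ((y : ℝ) - x) ^ (1 / 2 : ℝ) := by
  obtain ⟨hgi, hgD⟩ := integrable_of_lintegral_ofReal_le (K := fun x => g x ^ 2)
    (h.2.1.aestronglyMeasurable.pow 2) (fun _ => sq_nonneg _) (sq_nonneg D) hg
  set l : ℝ := Real.sqrt (y - x) with hl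
  have hl0 : 0 < l := Real.sqrt_pos.2 (sub_pos.2 hxy)
  have hl2 : l * l = y - x := Real.mul_self_sqrt (sub_pos.2 hxy).le
  have approx : ∀ᶠ ε in 𝓝[>] (0 : ℝ), |f x - f y| ≤ 2 * ε + (l * D ^ 2 + (l * l + 2 * ε) / l) / 2 := by
    filter_upwards [self_mem_nhdsWithin] with ε hε
    have hε : 0 < ε := hε
    obtain ⟨δ₁, hδ₁, H₁⟩ := Metric.continuous_iff.1 hf x ε hε
    obtain ⟨δ₂, hδ₂, H₂⟩ := Metric.continuous_iff.1 hf y ε hε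
    obtain ⟨r, hr0, hr⟩ : ∃ r, 0 < r ∧ r < min (min δ₁ δ₂) (min ε (min (x - a) (b - y))) :=
      exists_between (lt_min (lt_min hδ₁ hδ₂) (lt_min hε (lt_min (sub_pos.2 x.2.1)
        (sub_pos.2 y.2.2))))
    simp only [lt_min_iff] at hr
    obtain ⟨⟨r1, r2⟩, r3, r4, r5⟩ := hr
    obtain ⟨ψ₁, ψ₂, φ, hφ, hφc, hφs, hφ1, hφd, p1, p2, c1, c2, s1, s2, i1, i2⟩ :=
      exists_contDiff_deriv_eq_sub hxy hr0
    have hsub : ∀ u v : ℝ, a < u → v < b → Set.Icc u v ⊆ Set.Ioo a b := fun u v hu hv z hz =>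
      ⟨hu.trans_le hz.1, hz.2.trans_lt hv⟩
    have s1' : tsupport ψ₁ ⊆ Set.Ioo a b := by
      refine s1.trans ?_
      rw [Real.closedBall_eq_Icc]
      exact hsub _ _ (by linarith) (by linarith)
    have s2' : tsupport ψ₂ ⊆ Set.Ioo a b := by
      refine s2.trans ?_
      rw [Real.closedBall_eq_Icc]
      exact hsub _ _ (by linarith) (by linarith)
    have e1 := abs_integral_mul_sub_le measurableSet_Ioo h.1 x (r := r) (ε := ε)
      (fun z hz => (H₁ z (lt_of_le_of_lt hz r1)).le) c1 p1 s1 s1' i1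
    have e2 := abs_integral_mul_sub_le measurableSet_Ioo h.1 y (r := r) (ε := ε)
      (fun z hz => (H₂ z (lt_of_le_of_lt hz r2)).le) c2 p2 s2 s2' i2
    have hφs' : tsupport φ ⊆ Set.Ioo a b := hφs.trans (hsub _ _ (by linarith) (by linarith))
    have e3 := h.2.2 φ hφ hφc hφs'
    simp only [iteratedDeriv_one, hφd, pow_one, mul_sub] at e3
    rw [integral_sub
      (integrable_mul_test h.1 c1 ((isCompact_closedBall _ _).of_isClosed_subset
        (isClosed_tsupport _) s1) s1')
      (integrable_mul_test h.1 c2 ((isCompact_closedBall _ _).of_isClosed_subset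
        (isClosed_tsupport _) s2) s2')] at e3
    have hset : MeasurableSet ((Subtype.val : Set.Ioo a b → ℝ) ⁻¹' Set.Icc (x - r) (y + r)) :=
      measurable_subtype_coe measurableSet_Icc
    have e4 : |∫ z : Set.Ioo a b, g z * φ z ∂(lebesgueOn (Set.Ioo a b))| ≤
        (l * D ^ 2 + (l * l + 2 * ε) / l) / 2 := by
      have hind : Integrable (((Subtype.val : Set.Ioo a b → ℝ) ⁻¹' Set.Icc (x - r) (y + r)).indicator
          (fun _ => (1 : ℝ))) (lebesgueOn (Set.Ioo a b)) :=
        (integrable_const 1).indicator hset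
      rw [← Real.norm_eq_abs]
      calc _ ≤ ∫ z : Set.Ioo a b, (l / 2 * g z ^ 2 + 1 / (2 * l) *
              ((Subtype.val : Set.Ioo a b → ℝ) ⁻¹' Set.Icc (x - r) (y + r)).indicator
              (fun _ => (1 : ℝ)) z) ∂(lebesgueOn (Set.Ioo a b)) := by
            refine norm_integral_le_of_norm_le ((hgi.const_mul _).add (hind.const_mul _))
              (Eventually.of_forall fun z => ?_)
            simp only [norm_mul, Real.norm_eq_abs]
            by_cases hz : (z : ℝ) ∈ Set.Icc (x - r : ℝ) (y + r)
            · rw [Set.indicator_of_mem (by exact hz), mul_one]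
              have a1 : |g z| * |φ z| ≤ |g z| * 1 :=
                mul_le_mul_of_nonneg_left (hφ1 z) (abs_nonneg _)
              -- Young's inequality replaces Cauchy–Schwarz. With the parameter `l = √(y - x)` both
              -- resulting terms are of order `l`.
              have a2 : |g z| ≤ l / 2 * g z ^ 2 + 1 / (2 * l) := by
                rw [← sub_nonneg, ← sq_abs (g z)]
                have : l / 2 * |g z| ^ 2 + 1 / (2 * l) - |g z| = (l * |g z| - 1) ^ 2 / (2 * l) := by
                  field_simp; ring
                rw [this]; positivity
              linarith
            · rw [image_eq_zero_of_notMem_tsupport fun h' => hz (hφs h'), abs_zero, mul_zero]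
              have : 0 ≤ ((Subtype.val : Set.Ioo a b → ℝ) ⁻¹' Set.Icc (x - r) (y + r)).indicator
                (fun _ => (1 : ℝ)) z := Set.indicator_nonneg (fun _ _ => zero_le_one) _
              positivity
        _ = l / 2 * ∫ z : Set.Ioo a b, g z ^ 2 ∂(lebesgueOn (Set.Ioo a b)) +
              1 / (2 * l) * (y + r - (x - r)) := by
            rw [integral_add (hgi.const_mul _) (hind.const_mul _), integral_const_mul,
              integral_const_mul, integral_indicator hset, setIntegral_const, smul_eq_mul, mul_one,
              measureReal_def, comap_subtype_coe_apply measurableSet_Ioo, Subtype.image_preimage_coe,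
              Set.inter_eq_self_of_subset_right (hsub _ _ (by linarith) (by linarith)),
              Real.volume_Icc, ENNReal.toReal_ofReal (by linarith)]
        _ ≤ l / 2 * D ^ 2 + 1 / (2 * l) * (l * l + 2 * ε) := by
            gcongr
            linarith
        _ = _ := by field_simp
    have e5 : |(∫ z : Set.Ioo a b, f z * ψ₁ z ∂(lebesgueOn (Set.Ioo a b))) -
        ∫ z : Set.Ioo a b, f z * ψ₂ z ∂(lebesgueOn (Set.Ioo a b))| ≤
        (l * D ^ 2 + (l * l + 2 * ε) / l) / 2 := by
      rw [e3, abs_mul, abs_neg, abs_one, one_mul]; exact e4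
    rw [abs_le] at *
    constructor <;> linarith [e1.1, e1.2, e2.1, e2.2, e5.1, e5.2]
  have lim : Tendsto (fun ε : ℝ => 2 * ε + (l * D ^ 2 + (l * l + 2 * ε) / l) / 2) (𝓝[>] 0)
      (𝓝 ((D ^ 2 + 1) / 2 * ((y : ℝ) - x) ^ (1 / 2 : ℝ))) := by
    have e : (D ^ 2 + 1) / 2 * ((y : ℝ) - x) ^ (1 / 2 : ℝ) =
        2 * 0 + (l * D ^ 2 + (l * l + 2 * 0) / l) / 2 := by
      rw [← Real.sqrt_eq_rpow, ← hl]
      field_simp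
      ring
    rw [e]
    refine Tendsto.mono_left (Continuous.tendsto ?_ 0) nhdsWithin_le_nhds
    fun_prop
  exact ge_of_tendsto lim approx

/-! ### Campanato estimate from the Slobodeckij integral. -/

/-- The difference of the averages is the average of `f x - f y` over `I ×ˢ J`, and Young's
inequality with the free parameter `c` bounds it by the energy integral of `K`. -/
theorem abs_average_sub_average_le {X : Type*} [MeasurableSpace X] {μ : Measure X}
    [IsFiniteMeasure μ] {f : X → ℝ} (hf : Integrable f μ) {I J : Set X}
    (hI : MeasurableSet I) (hJ : MeasurableSet J) {K : X × X → ℝ} (hK : Integrable K (μ.prod μ))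
    (hK0 : ∀ z, 0 ≤ K z) {E : ℝ} (hE : ∫ z, K z ∂(μ.prod μ) ≤ E)
    {A : ℝ} (hA : 0 ≤ A) (hfK : ∀ x ∈ I, ∀ y ∈ J, (f x - f y) ^ 2 ≤ A * K (x, y))
    (hI0 : 0 < μ.real I) (hJ0 : 0 < μ.real J) {c : ℝ} (hc : 0 < c) :
    |(∫ x in I, f x ∂μ) / μ.real I - (∫ x in J, f x ∂μ) / μ.real J| ≤
      c / 2 + A * E / (2 * c * (μ.real I * μ.real J)) := by
  set M := μ.real I * μ.real J with hM
  have hM0 : 0 < M := mul_pos hI0 hJ0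
  have hp : (μ.prod μ).restrict (I ×ˢ J) = (μ.restrict I).prod (μ.restrict J) :=
    (Measure.prod_restrict I J).symm
  have e : ∫ z in I ×ˢ J, (f z.1 - f z.2) ∂(μ.prod μ) =
      (∫ x in I, f x ∂μ) * μ.real J - (∫ x in J, f x ∂μ) * μ.real I := by
    rw [hp, integral_sub (hf.restrict.comp_fst _) (hf.restrict.comp_snd _)]
    have a1 := integral_prod_mul (μ := μ.restrict I) (ν := μ.restrict J) f (fun _ => (1 : ℝ))
    have a2 := integral_prod_mul (μ := μ.restrict I) (ν := μ.restrict J) (fun _ => (1 : ℝ)) f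
    simp only [mul_one, one_mul, integral_const, smul_eq_mul, measureReal_restrict_apply_univ] at a1 a2
    rw [a1, a2]; ring
  have e' : (∫ x in I, f x ∂μ) / μ.real I - (∫ x in J, f x ∂μ) / μ.real J =
      (∫ z in I ×ˢ J, (f z.1 - f z.2) ∂(μ.prod μ)) / M := by
    rw [e, hM]; field_simp
  have b : ‖∫ z in I ×ˢ J, (f z.1 - f z.2) ∂(μ.prod μ)‖ ≤
      ∫ z in I ×ˢ J, (c / 2 + A / (2 * c) * K z) ∂(μ.prod μ) := by
    refine norm_integral_le_of_norm_le ((integrable_const _).add (hK.restrict.const_mul _))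
      ((ae_restrict_iff' (hI.prod hJ)).2 (Eventually.of_forall fun z hz => ?_))
    have h1 := hfK z.1 hz.1 z.2 hz.2
    rw [Real.norm_eq_abs]
    have h2 : |f z.1 - f z.2| ≤ c / 2 + (f z.1 - f z.2) ^ 2 / (2 * c) := by
      rw [← sub_nonneg, ← sq_abs (f z.1 - f z.2)]
      have : c / 2 + |f z.1 - f z.2| ^ 2 / (2 * c) - |f z.1 - f z.2| =
          (|f z.1 - f z.2| - c) ^ 2 / (2 * c) := by field_simp; ring
      rw [this]; positivity
    have h3 : (f z.1 - f z.2) ^ 2 / (2 * c) ≤ A * K z / (2 * c) := by gcongr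
    calc _ ≤ _ := h2
      _ ≤ c / 2 + A * K z / (2 * c) := by linarith
      _ = _ := by ring
  have b' : ∫ z in I ×ˢ J, (c / 2 + A / (2 * c) * K z) ∂(μ.prod μ) ≤
      c / 2 * M + A / (2 * c) * E := by
    rw [integral_add (integrable_const _) (hK.restrict.const_mul _), integral_const_mul,
      setIntegral_const, measureReal_prod_prod, smul_eq_mul, mul_comm (μ.real I * _)]
    have h4 : ∫ z in I ×ˢ J, K z ∂(μ.prod μ) ≤ E :=
      (setIntegral_le_integral hK (Eventually.of_forall hK0)).trans hE
    have : 0 ≤ A / (2 * c) := by positivity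
    gcongr
  rw [e', abs_div, abs_of_pos hM0, div_le_iff₀ hM0]
  calc _ ≤ c / 2 * M + A / (2 * c) * E := b.trans b'
    _ = _ := by field_simp

theorem tendsto_average_of_continuousAt {X : Type*} [PseudoMetricSpace X] [MeasurableSpace X]
    {μ : Measure X} [IsFiniteMeasure μ] {f : X → ℝ} (hf : Integrable f μ) {p : X}
    (hp : ContinuousAt f p) {S : ℕ → Set X}
    (hS0 : ∀ n, 0 < μ.real (S n)) {δ : ℕ → ℝ} (hδ : Tendsto δ atTop (𝓝 0))
    (hSδ : ∀ n, ∀ z ∈ S n, dist z p ≤ δ n) :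
    Tendsto (fun n => (∫ x in S n, f x ∂μ) / μ.real (S n)) atTop (𝓝 (f p)) := by
  rw [Metric.tendsto_atTop]
  intro ε hε
  obtain ⟨η, hη, H⟩ := Metric.continuousAt_iff.1 hp (ε / 2) (half_pos hε)
  obtain ⟨N, hN⟩ := (hδ.eventually (gt_mem_nhds hη)).exists_forall_of_atTop
  refine ⟨N, fun n hn => ?_⟩
  have h1 : ‖∫ x in S n, (f x - f p) ∂μ‖ ≤ ε / 2 * μ.real (S n) :=
    norm_setIntegral_le_of_norm_le_const (measure_lt_top _ _)
      fun z hz => (H ((hSδ n z hz).trans_lt (hN n hn))).le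
  rw [integral_sub hf.restrict (integrable_const _), setIntegral_const, smul_eq_mul,
    Real.norm_eq_abs] at h1
  rw [Real.dist_eq]
  have : (∫ x in S n, f x ∂μ) / μ.real (S n) - f p =
      ((∫ x in S n, f x ∂μ) - μ.real (S n) * f p) / μ.real (S n) := by
    have := (hS0 n).ne'
    field_simp
  rw [this, abs_div, abs_of_pos (hS0 n), div_lt_iff₀ (hS0 n)]
  have := mul_pos (half_pos hε) (hS0 n)
  linarith

/-- Campanato's argument: the value at a point differs little from the average over the first set of
a dyadic sequence shrinking to it. -/
theorem dist_average_le_of_dyadic {a b t D l : ℝ} (ht : 1 / 2 < t) (ht1 : ⌊t⌋₊ = 0)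
    {f : Set.Ioo a b → ℝ} (hf : Continuous f) (hfi : Integrable f (lebesgueOn (Set.Ioo a b)))
    (hE : ∫⁻ z : Set.Ioo a b × Set.Ioo a b, ENNReal.ofReal ((f z.1 - f z.2) ^ 2 /
      slobodeckijWeight (Set.Ioo a b) t z)
      ∂((lebesgueOn (Set.Ioo a b)).prod (lebesgueOn (Set.Ioo a b))) ≤ ENNReal.ofReal (D ^ 2))
    (hl : 0 < l) (p : Set.Ioo a b) {S : ℕ → Set (Set.Ioo a b)} (hS : ∀ n, MeasurableSet (S n))
    (hSμ : ∀ n, (lebesgueOn (Set.Ioo a b)).real (S n) = l * (1 / 2) ^ n)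
    (hSd : ∀ n, ∀ x ∈ S n, ∀ y ∈ S n, |(x : ℝ) - y| ≤ l * (1 / 2) ^ n)
    (hSs : ∀ n, S (n + 1) ⊆ S n) (hSp : ∀ n, ∀ z ∈ S n, dist z p ≤ l * (1 / 2) ^ n) :
    |(∫ x in S 0, f x ∂(lebesgueOn (Set.Ioo a b))) / (lebesgueOn (Set.Ioo a b)).real (S 0) - f p| ≤
      (1 / 2 + D ^ 2) * l ^ (t - 1 / 2) / (1 - (1 / 2) ^ (t - 1 / 2)) := by
  set μ := lebesgueOn (Set.Ioo a b) with hμ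
  obtain ⟨hK, hKE⟩ := integrable_of_lintegral_ofReal_le (μ := μ.prod μ)
    (K := fun z => (f z.1 - f z.2) ^ 2 / slobodeckijWeight (Set.Ioo a b) t z)
    (aestronglyMeasurable_iff_aemeasurable.2
      ((((hf.measurable.comp measurable_fst).sub (hf.measurable.comp measurable_snd)).pow_const
        2).div (measurable_slobodeckijWeight _ t)).aemeasurable)
    (fun z => div_nonneg (sq_nonneg _) (slobodeckijWeight_nonneg _ t z)) (sq_nonneg D) hE
  set r : ℝ := (1 / 2) ^ (t - 1 / 2) with hr
  have hr1 : r < 1 := Real.rpow_lt_one (by norm_num) (by norm_num) (by linarith)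
  have hS0 : ∀ n, 0 < μ.real (S n) := fun n => by rw [hSμ]; positivity
  have key : ∀ n, dist ((∫ x in S n, f x ∂μ) / μ.real (S n))
      ((∫ x in S (n + 1), f x ∂μ) / μ.real (S (n + 1))) ≤
      (1 / 2 + D ^ 2) * l ^ (t - 1 / 2) * r ^ n := by
    intro n
    set L := l * (1 / 2) ^ n with hL
    have hL0 : 0 < L := by positivity
    have hc : 0 < L ^ (t - 1 / 2) := Real.rpow_pos_of_pos hL0 _
    -- Points of `S n` are at distance at most `L`, whence `A = L ^ (1 + 2t)`. The two sets have
    -- measures `L` and `L / 2`, and `c = L ^ (t - 1/2)` balances the two terms to `(1/2 + D²) L ^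
    -- (t - 1/2)`, which decays geometrically since `t > 1/2`.
    have h := abs_average_sub_average_le (A := L ^ (1 + 2 * t)) (c := L ^ (t - 1 / 2)) hfi (hS n)
      (hS (n + 1)) hK
      (fun z => div_nonneg (sq_nonneg _) (slobodeckijWeight_nonneg _ t z)) hKE (by positivity)
      (fun x hx y hy => ?_) (hS0 n) (hS0 (n + 1)) hc
    · rw [Real.dist_eq]
      refine h.trans (le_of_eq ?_)
      have e1 : L ^ (1 + 2 * t) = L ^ (t - 1 / 2) * L ^ (t - 1 / 2) * L ^ 2 := by
        rw [← Real.rpow_two, ← Real.rpow_add hL0, ← Real.rpow_add hL0]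
        congr 1; ring
      have e2 : L ^ (t - 1 / 2) = l ^ (t - 1 / 2) * r ^ n := by
        rw [hL, Real.mul_rpow hl.le (by positivity), hr, ← Real.rpow_natCast, ← Real.rpow_natCast,
          ← Real.rpow_mul (by norm_num), ← Real.rpow_mul (by norm_num), mul_comm (n : ℝ)]
      have e3 : l * (1 / 2) ^ (n + 1) = L / 2 := by rw [hL, pow_succ]; ring
      rw [hSμ, hSμ, e3, e1, mul_assoc (1 / 2 + D ^ 2), ← e2]
      field_simp
      simp only [hL]; ring
    · have hw : slobodeckijWeight (Set.Ioo a b) t (x, y) = |(x : ℝ) - y| ^ (1 + 2 * t) := by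
        simp [slobodeckijWeight, ht1]
      simp only [hw]
      rcases eq_or_ne x y with rfl | hne
      · simp
      · have hpos : 0 < |(x : ℝ) - y| :=
          abs_pos.2 (sub_ne_zero.2 fun h => hne (Subtype.ext h))
        have h1 : |(x : ℝ) - y| ^ (1 + 2 * t) ≤ L ^ (1 + 2 * t) :=
          Real.rpow_le_rpow hpos.le (hSd n x hx y (hSs n hy)) (by linarith)
        have h2 := Real.rpow_pos_of_pos hpos (1 + 2 * t)
        rw [← mul_div_assoc, le_div_iff₀ h2, mul_comm]
        gcongr
  have hlim := tendsto_average_of_continuousAt hfi hf.continuousAt hS0 (δ := fun n => l * (1 / 2) ^ n)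
    (by simpa using (tendsto_pow_atTop_nhds_zero_of_lt_one (r := (1 / 2 : ℝ)) (by norm_num)
      (by norm_num)).const_mul l) hSp
  have := dist_le_of_le_geometric_of_tendsto₀ r _ hr1 key hlim
  rwa [Real.dist_eq] at this

theorem abs_sub_le_of_slobodeckij {a b t D : ℝ} (ht : 1 / 2 < t) (ht1 : ⌊t⌋₊ = 0)
    {f : Set.Ioo a b → ℝ} (hf : Continuous f) (hfi : Integrable f (lebesgueOn (Set.Ioo a b)))
    (hE : ∫⁻ z : Set.Ioo a b × Set.Ioo a b, ENNReal.ofReal ((f z.1 - f z.2) ^ 2 /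
      slobodeckijWeight (Set.Ioo a b) t z)
      ∂((lebesgueOn (Set.Ioo a b)).prod (lebesgueOn (Set.Ioo a b))) ≤ ENNReal.ofReal (D ^ 2))
    {x y : Set.Ioo a b} (hxy : (x : ℝ) < y) :
    |f x - f y| ≤ 2 * ((1 / 2 + D ^ 2) / (1 - (1 / 2) ^ (t - 1 / 2))) *
      ((y : ℝ) - x) ^ (t - 1 / 2) := by
  set l : ℝ := y - x with hl
  have hl0 : 0 < l := sub_pos.2 hxy
  have hn : ∀ n : ℕ, 0 < l * (1 / 2) ^ n ∧ l * (1 / 2) ^ n ≤ l := fun n =>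
    ⟨by positivity, mul_le_of_le_one_right hl0.le (pow_le_one₀ (by norm_num) (by norm_num))⟩
  have hn' : ∀ n : ℕ, l * (1 / 2) ^ (n + 1) ≤ l * (1 / 2) ^ n := fun n => by
    rw [pow_succ]; linarith [hn n]
  have hμ : ∀ u v : ℝ, u ≤ v → x ≤ u → v ≤ y → (lebesgueOn (Set.Ioo a b)).real
      ((Subtype.val : Set.Ioo a b → ℝ) ⁻¹' Set.Ioc u v) = v - u := by
    intro u v huv hu hv
    have hsub : Set.Ioc u v ⊆ Set.Ioo a b := fun z hz =>
      ⟨x.2.1.trans_le (hu.trans hz.1.le), (hz.2.trans hv).trans_lt y.2.2⟩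
    rw [measureReal_def, comap_subtype_coe_apply measurableSet_Ioo, Subtype.image_preimage_coe,
      Set.inter_eq_self_of_subset_right hsub, Real.volume_Ioc, ENNReal.toReal_ofReal (by linarith)]
  have h1 := dist_average_le_of_dyadic ht ht1 hf hfi hE hl0 x
    (S := fun n => Subtype.val ⁻¹' Set.Ioc (x : ℝ) (x + l * (1 / 2) ^ n))
    (fun n => measurable_subtype_coe measurableSet_Ioc)
    (fun n => by rw [hμ _ _ (by linarith [hn n]) le_rfl (by linarith [hn n])]; ring)
    (fun n z hz w hw => by
      rw [abs_le]; constructor <;> linarith [hz.1, hz.2, hw.1, hw.2])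
    (fun n z hz => ⟨hz.1, hz.2.trans (by linarith [hn' n])⟩)
    (fun n z hz => by
      rw [Subtype.dist_eq, Real.dist_eq, abs_le]; constructor <;> linarith [hz.1, hz.2, hn n])
  have h2 := dist_average_le_of_dyadic ht ht1 hf hfi hE hl0 y
    (S := fun n => Subtype.val ⁻¹' Set.Ioc (y - l * (1 / 2) ^ n) (y : ℝ))
    (fun n => measurable_subtype_coe measurableSet_Ioc)
    (fun n => by rw [hμ _ _ (by linarith [hn n]) (by linarith [hn n]) le_rfl]; ring)
    (fun n z hz w hw => by
      rw [abs_le]; constructor <;> linarith [hz.1, hz.2, hw.1, hw.2])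
    (fun n z hz => ⟨by linarith [hn' n, hz.1], hz.2⟩)
    (fun n z hz => by
      rw [Subtype.dist_eq, Real.dist_eq, abs_le]; constructor <;> linarith [hz.1, hz.2, hn n])
  -- Both dyadic sequences start from the same interval `(x, y]`, so its average links `f x` to `f
  -- y`.
  have e1 : (x : ℝ) + l * (1 / 2) ^ 0 = y := by simp [hl]
  have e2 : (y : ℝ) - l * (1 / 2) ^ 0 = x := by simp [hl]
  simp only [e1] at h1
  simp only [e2] at h2
  have e3 : 2 * ((1 / 2 + D ^ 2) / (1 - (1 / 2 : ℝ) ^ (t - 1 / 2))) * l ^ (t - 1 / 2) =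
      (1 / 2 + D ^ 2) * l ^ (t - 1 / 2) / (1 - (1 / 2 : ℝ) ^ (t - 1 / 2)) +
      (1 / 2 + D ^ 2) * l ^ (t - 1 / 2) / (1 - (1 / 2 : ℝ) ^ (t - 1 / 2)) := by ring
  rw [e3]
  rw [abs_le] at *
  constructor <;> linarith [h1.1, h1.2, h2.1, h2.2]

/-- Functions in a Sobolev ball of order greater than `1/2` share a Hölder modulus of continuity. -/
theorem exists_holder_bound_of_sobolevENormSq_le (a b : ℝ) {t : ℝ} (ht : 1 / 2 < t) (D : ℝ) :
    ∃ C σ : ℝ, 0 ≤ C ∧ 0 < σ ∧ ∀ f : Set.Ioo a b →ᵇ ℝ,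
      sobolevENormSq (Set.Ioo a b) t f ≤ ENNReal.ofReal (D ^ 2) →
      ∀ x y : Set.Ioo a b, |f x - f y| ≤ C * |(x : ℝ) - y| ^ σ := by
  suffices H : ∃ C σ : ℝ, 0 ≤ C ∧ 0 < σ ∧ ∀ f : Set.Ioo a b →ᵇ ℝ,
      sobolevENormSq (Set.Ioo a b) t f ≤ ENNReal.ofReal (D ^ 2) →
      ∀ x y : Set.Ioo a b, (x : ℝ) < y → |f x - f y| ≤ C * ((y : ℝ) - x) ^ σ by
    obtain ⟨C, σ, hC, hσ, H⟩ := H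
    refine ⟨C, σ, hC, hσ, fun f hf x y => ?_⟩
    rcases lt_trichotomy (x : ℝ) y with h | h | h
    · rw [abs_sub_comm (x : ℝ), abs_of_pos (sub_pos.2 h)]
      exact H f hf x y h
    · rw [Subtype.ext h]; simp [Real.zero_rpow hσ.ne']
    · rw [abs_sub_comm (f x), abs_of_pos (sub_pos.2 h)]
      exact H f hf y x h
  -- For `1/2 < t < 1` the double integral of `f` itself is available; for `t ≥ 1` the first weak
  -- derivative suffices and gives exponent `1/2`.
  rcases Nat.eq_zero_or_pos ⌊t⌋₊ with h0 | h1
  · have hr1 : (1 / 2 : ℝ) ^ (t - 1 / 2) < 1 :=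
      Real.rpow_lt_one (by norm_num) (by norm_num) (by linarith)
    refine ⟨2 * ((1 / 2 + D ^ 2) / (1 - (1 / 2) ^ (t - 1 / 2))), t - 1 / 2, ?_, by linarith,
      fun f hf x y hxy => ?_⟩
    · have := sub_pos.2 hr1
      positivity
    · have hfi : Integrable f (lebesgueOn (Set.Ioo a b)) := f.integrable _
      refine abs_sub_le_of_slobodeckij ht h0 f.continuous hfi (le_trans ?_ hf) hxy
      rw [sobolevENormSq_eq_sobolevForm isOpen_Ioo (g := fun _ => f) fun k hk => by
        obtain rfl : k = 0 := by omega
        exact hasWeakDeriv_zero hfi.locallyIntegrable, sobolevForm, if_neg]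
      · exact le_add_self
      · rw [h0, Nat.cast_zero]; linarith
  · refine ⟨(D ^ 2 + 1) / 2, 1 / 2, by positivity, by norm_num, fun f hf x y hxy => ?_⟩
    have w := hasWeakDeriv_of_sobolevENormSq_ne_top (ne_top_of_le_ne_top ENNReal.ofReal_ne_top hf)
    refine abs_sub_le_of_hasWeakDeriv_one f.continuous (w 1 h1) ?_ hxy
    rw [sobolevENormSq_eq_sobolevForm isOpen_Ioo w] at hf
    exact (lintegral_sq_le_sobolevForm (fun k => weakDeriv _ k f) h1).trans hf

/-! ### Closedness of Sobolev balls in the uniform norm -/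

/-- A point in the closure of a sublevel set of a quadratic form is a limit of points of that set
along which the form is Cauchy at a prescribed rate. -/
theorem exists_seq_tendsto_quadratic_cauchy {X : Type*} [NormedAddCommGroup X] [NormedSpace ℝ X]
    (Q : X → ℝ≥0∞) (hQ : ∀ f h, Q f ≠ ⊤ → Q h ≠ ⊤ →
      Q ((1 / 2 : ℝ) • f + (1 / 2 : ℝ) • h) + 4⁻¹ * Q (f - h) = 2⁻¹ * Q f + 2⁻¹ * Q h)
    {E : ℝ≥0∞} (hE : E ≠ ⊤) {f : X} (hf : f ∈ closure {q | Q q ≤ E}) {η : ℕ → ℝ≥0∞}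
    (hη : Antitone η) (hη0 : ∀ n, η n ≠ 0) :
    ∃ q : ℕ → X, Tendsto q atTop (𝓝 f) ∧ (∀ n, Q (q n) ≤ E) ∧
      ∀ N n m, N ≤ n → N ≤ m → Q (q n - q m) ≤ 8 * η N := by
  have half : ∀ x : ℝ≥0∞, 2⁻¹ * x + 2⁻¹ * x = x := fun x => by
    rw [← add_mul, ENNReal.inv_two_add_inv_two, one_mul]
  let S : ℕ → Set X := fun n => {q | Q q ≤ E ∧ dist q f < 1 / ((n : ℝ) + 1)}
  have hSanti : Antitone S := fun n m hnm q hq =>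
    ⟨hq.1, hq.2.trans_le (Nat.one_div_le_one_div hnm)⟩
  have hSne : ∀ n, (S n).Nonempty := fun n => by
    obtain ⟨q, hq, hd⟩ := Metric.mem_closure_iff.1 hf (1 / ((n : ℝ) + 1)) Nat.one_div_pos_of_nat
    exact ⟨q, hq, by rwa [dist_comm]⟩
  -- `d n` is the least energy in the ball of radius `1 / (n + 1)` around `f`. It increases to a
  -- finite limit, and near-minimizers of it form the required sequence.
  let d : ℕ → ℝ≥0∞ := fun n => ⨅ q ∈ S n, Q q
  have hd : ∀ n, ∀ q ∈ S n, d n ≤ Q q := fun n q hq => iInf₂_le q hq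
  have hdm : Monotone d := fun n m hnm => le_iInf₂ fun q hq => hd n q (hSanti hnm hq)
  have hdE : ∀ n, d n ≤ E := fun n => by
    obtain ⟨q, hq⟩ := hSne n
    exact (hd n q hq).trans hq.1
  have hdtop : ∀ n, d n ≠ ⊤ := fun n => ne_top_of_le_ne_top hE (hdE n)
  have hsup : (⨆ n, d n) ≠ ⊤ := ne_top_of_le_ne_top hE (iSup_le hdE)
  have hev : ∀ N, ∀ᶠ n in atTop, (⨆ n, d n) ≤ d n + η N := by
    intro N
    have : Tendsto (fun n => d n + η N) atTop (𝓝 ((⨆ n, d n) + η N)) :=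
      (tendsto_atTop_iSup hdm).add_const _
    filter_upwards [this.eventually (lt_mem_nhds (ENNReal.lt_add_right hsup (hη0 N)))] with n hn
    exact hn.le
  obtain ⟨φ, hφ, hφd⟩ := extraction_forall_of_eventually hev
  have hq : ∀ N, ∃ q ∈ S (φ N), Q q ≤ (⨆ n, d n) + η N := by
    intro N
    by_contra! h
    have h1 : (⨆ n, d n) + η N ≤ d (φ N) := le_iInf₂ fun q hq => (h q hq).le
    have h2 := h1.trans (le_iSup d (φ N))
    exact absurd h2 (not_le.2 (ENNReal.lt_add_right hsup (hη0 N)))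
  choose q hqS hqQ using hq
  refine ⟨q, ?_, fun n => (hqS n).1, ?_⟩
  · rw [tendsto_iff_dist_tendsto_zero]
    refine squeeze_zero (fun _ => dist_nonneg) (fun n => ?_) tendsto_one_div_add_atTop_nhds_zero_nat
    exact (hqS n).2.le.trans (Nat.one_div_le_one_div (hφ.id_le n))
  · intro N n m hn hm
    have hnS := hSanti (hφ.monotone hn) (hqS n)
    have hmS := hSanti (hφ.monotone hm) (hqS m)
    have id1 := hQ (q n) (q m) (ne_top_of_le_ne_top hE hnS.1) (ne_top_of_le_ne_top hE hmS.1)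
    set mid := (1 / 2 : ℝ) • q n + (1 / 2 : ℝ) • q m with hmid
    -- The midpoint stays in the same convex set, so its energy is at least `d (φ N)`. The
    -- parallelogram identity leaves only the small excess for `Q (q n - q m)`.
    have hmidS : mid ∈ S (φ N) := by
      refine ⟨?_, ?_⟩
      · calc Q mid ≤ _ := le_self_add
          _ = _ := id1
          _ ≤ 2⁻¹ * E + 2⁻¹ * E := by gcongr <;> [exact hnS.1; exact hmS.1]
          _ = E := half E
      · have := (convex_ball f (1 / ((φ N : ℝ) + 1))) hnS.2 hmS.2 (a := 1 / 2) (b := 1 / 2)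
          (by norm_num) (by norm_num) (by norm_num)
        exact this
    have h1 : d (φ N) + 4⁻¹ * Q (q n - q m) ≤ d (φ N) + (η N + η N) := by
      calc _ ≤ Q mid + 4⁻¹ * Q (q n - q m) := by gcongr; exact hd _ _ hmidS
        _ = _ := id1
        _ ≤ 2⁻¹ * ((⨆ n, d n) + η N) + 2⁻¹ * ((⨆ n, d n) + η N) := by
            gcongr
            · exact (hqQ n).trans (by gcongr; exact hη hn)
            · exact (hqQ m).trans (by gcongr; exact hη hm)
        _ = (⨆ n, d n) + η N := half _
        _ ≤ d (φ N) + η N + η N := by gcongr; exact hφd N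
        _ = _ := add_assoc _ _ _
    have h2 := (ENNReal.add_le_add_iff_left (hdtop _)).1 h1
    calc Q (q n - q m) = 4 * (4⁻¹ * Q (q n - q m)) := by
          rw [← mul_assoc, ENNReal.mul_inv_cancel (by norm_num) (by norm_num), one_mul]
      _ ≤ 4 * (η N + η N) := by gcongr
      _ = 8 * η N := by ring

/-! ### Limits of weak derivatives. -/

theorem eLpNorm_two_eq_lintegral_ofReal_sq {X : Type*} [MeasurableSpace X] {μ : Measure X}
    (u : X → ℝ) : eLpNorm u 2 μ = (∫⁻ x, ENNReal.ofReal (u x ^ 2) ∂μ) ^ (1 / 2 : ℝ) := by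
  rw [eLpNorm_eq_lintegral_rpow_enorm_toReal two_ne_zero ENNReal.ofNat_ne_top]
  simp only [ENNReal.toReal_ofNat, ENNReal.rpow_ofNat, Real.enorm_eq_ofReal_abs]
  congr 2; ext x
  rw [← ENNReal.ofReal_pow (abs_nonneg _), sq_abs]

/-- The prescribed rate is summable, so the whole sequence converges almost everywhere, as Fatou's
lemma needs, and not only in `L²`. The exponent `N + 1` makes the bound `2⁻¹ ^ N` strict. -/
theorem exists_ae_limit_of_lintegral_sq_cauchy {X : Type*} [MeasurableSpace X] {μ : Measure X}
    {g : ℕ → X → ℝ} (hg : ∀ n, AEMeasurable (g n) μ)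
    (h : ∀ N n m, N ≤ n → N ≤ m →
      ∫⁻ x, ENNReal.ofReal ((g n x - g m x) ^ 2) ∂μ ≤ (2⁻¹ ^ (N + 1)) ^ 2) :
    ∃ G : X → ℝ, Measurable G ∧ (∀ᵐ x ∂μ, Tendsto (fun n => g n x) atTop (𝓝 (G x))) ∧
      Tendsto (fun n => eLpNorm (g n - G) 2 μ) atTop (𝓝 0) := by
  have hm : ∀ n, AEStronglyMeasurable (g n) μ := fun n => (hg n).aestronglyMeasurable
  have hB : ∑' n : ℕ, (2⁻¹ : ℝ≥0∞) ^ n ≠ ⊤ := by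
    rw [ENNReal.tsum_geometric]; simp
  have hc : ∀ N n m : ℕ, N ≤ n → N ≤ m → eLpNorm (g n - g m) 2 μ < 2⁻¹ ^ N := by
    intro N n m hn hm
    rw [eLpNorm_two_eq_lintegral_ofReal_sq]
    calc _ ≤ (((2⁻¹ : ℝ≥0∞) ^ (N + 1)) ^ 2) ^ (1 / 2 : ℝ) := by
          gcongr; exact h N n m hn hm
      _ = 2⁻¹ ^ (N + 1) := by
          rw [← ENNReal.rpow_natCast, ← ENNReal.rpow_mul]; norm_num
      _ < 2⁻¹ ^ N := by
          rw [pow_succ, ← div_eq_mul_inv]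
          exact ENNReal.half_lt_self (by simp) (by simp)
  have hae := Lp.ae_tendsto_of_cauchy_eLpNorm hm one_le_two hB hc
  obtain ⟨G, hG, hlim⟩ := exists_stronglyMeasurable_limit_of_tendsto_ae hm hae
  exact ⟨G, hG.measurable, hlim, Lp.cauchy_tendsto_of_tendsto hm G hB hc hlim⟩

theorem lintegral_ofReal_le_liminf {X : Type*} [MeasurableSpace X] {μ : Measure X}
    {u : ℕ → X → ℝ} {v : X → ℝ} (hu : ∀ n, AEMeasurable (fun x => ENNReal.ofReal (u n x)) μ)
    (h : ∀ᵐ x ∂μ, Tendsto (fun n => u n x) atTop (𝓝 (v x))) :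
    ∫⁻ x, ENNReal.ofReal (v x) ∂μ ≤ liminf (fun n => ∫⁻ x, ENNReal.ofReal (u n x) ∂μ) atTop := by
  refine le_trans (le_of_eq (lintegral_congr_ae ?_)) (lintegral_liminf_le' hu)
  filter_upwards [h] with x hx
  exact (ENNReal.tendsto_ofReal hx).liminf_eq.symm

theorem ENNReal.liminf_add_liminf_le (u v : ℕ → ℝ≥0∞) :
    liminf u atTop + liminf v atTop ≤ liminf (fun n => u n + v n) atTop := by
  have hm : ∀ u : ℕ → ℝ≥0∞, Monotone fun n => ⨅ i ≥ n, u i := fun u n m hnm =>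
    le_iInf₂ fun i hi => iInf₂_le i (hnm.trans hi)
  rw [liminf_eq_iSup_iInf_of_nat, liminf_eq_iSup_iInf_of_nat, liminf_eq_iSup_iInf_of_nat,
    ENNReal.iSup_add_iSup_of_monotone (hm u) (hm v)]
  refine iSup_mono fun n => le_iInf₂ fun i hi => ?_
  exact add_le_add (iInf₂_le i hi) (iInf₂_le i hi)

theorem ENNReal.sum_liminf_le {ι : Type*} (s : Finset ι) (u : ι → ℕ → ℝ≥0∞) :
    ∑ i ∈ s, liminf (u i) atTop ≤ liminf (fun n => ∑ i ∈ s, u i n) atTop := by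
  classical
  induction s using Finset.induction_on with
  | empty => simp
  | insert i s hi ih =>
    simp only [Finset.sum_insert hi]
    exact (add_le_add_right ih _).trans (ENNReal.liminf_add_liminf_le _ _)

/-- Lower semicontinuity of the Sobolev form under almost everywhere convergence. -/
theorem sobolevForm_le_liminf {Ω : Set ℝ} [SFinite (lebesgueOn Ω)] {s : ℝ}
    {g : ℕ → ℕ → Ω → ℝ} {G : ℕ → Ω → ℝ}
    (hg : ∀ n, ∀ k ≤ ⌊s⌋₊, AEMeasurable (g n k) (lebesgueOn Ω))
    (h : ∀ k ≤ ⌊s⌋₊, ∀ᵐ x ∂(lebesgueOn Ω), Tendsto (fun n => g n k x) atTop (𝓝 (G k x))) :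
    sobolevForm Ω s G ≤ liminf (fun n => sobolevForm Ω s (g n)) atTop := by
  unfold sobolevForm
  refine le_trans (add_le_add (le_trans (Finset.sum_le_sum fun k hk => ?_)
    (ENNReal.sum_liminf_le _ _)) ?_) (ENNReal.liminf_add_liminf_le _ _)
  · have hk : k ≤ ⌊s⌋₊ := by simpa [Nat.lt_succ_iff] using hk
    refine lintegral_ofReal_le_liminf (fun n => ((hg n k hk).pow_const 2).ennreal_ofReal) ?_
    filter_upwards [h k hk] with x hx
    exact hx.pow 2
  · split_ifs
    · exact zero_le
    · refine lintegral_ofReal_le_liminf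
        (fun n => aemeasurable_slobodeckij s (hg n _ le_rfl)) ?_
      filter_upwards [Measure.quasiMeasurePreserving_fst.ae (h _ le_rfl),
        Measure.quasiMeasurePreserving_snd.ae (h _ le_rfl)] with z h1 h2
      exact ((h1.sub h2).pow 2).div_const _

/-- Both sides of the integration by parts formula pass to the limit: the left by uniform
convergence, the right because `L²` convergence implies `L¹` convergence on a finite measure space.
-/
theorem HasWeakDeriv.of_tendsto {Ω : Set ℝ} [IsFiniteMeasure (lebesgueOn Ω)] {k : ℕ}
    {q : ℕ → Ω →ᵇ ℝ} {f : Ω →ᵇ ℝ} (hq : Tendsto q atTop (𝓝 f)) {g : ℕ → Ω → ℝ} {G : Ω → ℝ}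
    (h : ∀ n, HasWeakDeriv Ω k (q n) (g n)) (hG : Integrable G (lebesgueOn Ω))
    (hgG : Tendsto (fun n => eLpNorm (g n - G) 2 (lebesgueOn Ω)) atTop (𝓝 0)) :
    HasWeakDeriv Ω k f G := by
  refine ⟨(f.integrable _).locallyIntegrable, hG.locallyIntegrable, fun φ hφ hc hs => ?_⟩
  have l1 : Tendsto (fun n => ∫ x : Ω, q n x * iteratedDeriv k φ x ∂(lebesgueOn Ω)) atTop
      (𝓝 (∫ x : Ω, f x * iteratedDeriv k φ x ∂(lebesgueOn Ω))) := by
    have hφi : Integrable (fun x : Ω => 1 * iteratedDeriv k φ x) (lebesgueOn Ω) :=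
      integrable_mul_iteratedDeriv_test (f := fun _ => 1)
        (integrable_const (1 : ℝ)).locallyIntegrable hφ hc hs k
    simp only [one_mul] at hφi
    refine tendsto_integral_filter_of_dominated_convergence
      (fun x => (‖f‖ + 1) * ‖iteratedDeriv k φ x‖) (Eventually.of_forall fun n =>
        (q n).continuous.aestronglyMeasurable.mul hφi.aestronglyMeasurable) ?_
      (hφi.norm.const_mul _) ?_
    · filter_upwards [hq.norm.eventually (gt_mem_nhds (lt_add_one ‖f‖))] with n hn
      refine Eventually.of_forall fun x => ?_
      rw [norm_mul]
      exact mul_le_mul_of_nonneg_right (((q n).norm_coe_le_norm x).trans hn.le) (norm_nonneg _)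
    · refine Eventually.of_forall fun x => ?_
      exact (((BoundedContinuousFunction.evalCLM ℝ x).continuous.tendsto f).comp hq).mul_const _
  have l2 : Tendsto (fun n => ∫ x : Ω, g n x * φ x ∂(lebesgueOn Ω)) atTop
      (𝓝 (∫ x : Ω, G x * φ x ∂(lebesgueOn Ω))) := by
    obtain ⟨C, hC⟩ := hc.exists_bound_of_continuous hφ.continuous
    refine tendsto_integral_of_L1' _ (integrable_mul_test hG.locallyIntegrable hφ.continuous hc hs).aestronglyMeasurable
      (Eventually.of_forall fun n => integrable_mul_test (h n).2.1 hφ.continuous hc hs) ?_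
    have hb : ∀ n, eLpNorm ((fun x : Ω => g n x * φ x) - fun x : Ω => G x * φ x) 1 (lebesgueOn Ω) ≤
        ENNReal.ofReal C * (eLpNorm (g n - G) 2 (lebesgueOn Ω) *
          (lebesgueOn Ω) Set.univ ^ (1 / (1 : ℝ≥0∞).toReal - 1 / (2 : ℝ≥0∞).toReal)) := by
      intro n
      have hm : AEStronglyMeasurable (g n - G) (lebesgueOn Ω) :=
        ((h n).aemeasurable.aestronglyMeasurable.sub hG.aestronglyMeasurable)
      refine le_trans ?_ (mul_le_mul_right
        (eLpNorm_le_eLpNorm_mul_rpow_measure_univ one_le_two hm) _)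
      refine eLpNorm_le_mul_eLpNorm_of_ae_le_mul (Eventually.of_forall fun x => ?_) _
      simp only [Pi.sub_apply, ← sub_mul, norm_mul]
      rw [mul_comm]
      exact mul_le_mul_of_nonneg_right (hC x) (norm_nonneg _)
    refine tendsto_of_tendsto_of_tendsto_of_le_of_le tendsto_const_nhds ?_ (fun _ => zero_le) hb
    have hfin : (lebesgueOn Ω) Set.univ ^ (1 / (1 : ℝ≥0∞).toReal - 1 / (2 : ℝ≥0∞).toReal) ≠ ⊤ :=
      ENNReal.rpow_ne_top_of_nonneg (by norm_num) (measure_ne_top _ _)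
    have := ENNReal.Tendsto.const_mul (a := ENNReal.ofReal C)
      (ENNReal.Tendsto.mul_const hgG (Or.inr hfin)) (Or.inr ENNReal.ofReal_ne_top)
    simpa using this
  have l3 := l2.const_mul ((-1 : ℝ) ^ k)
  refine tendsto_nhds_unique l1 (l3.congr fun n => ?_)
  exact ((h n).2.2 φ hφ hc hs).symm

/-- A sequence of nearly minimal energy approaching `f` has weak derivatives that are Cauchy in
`L²`. Their limits are the weak derivatives of `f`, and Fatou's lemma preserves the norm bound, also
in the double integral. -/
theorem isClosed_sobolevENormSq_le {Ω : Set ℝ} (hΩ : IsOpen Ω) [IsFiniteMeasure (lebesgueOn Ω)]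
    (t : ℝ) {E : ℝ≥0∞} (hE : E ≠ ⊤) :
    IsClosed {f : Ω →ᵇ ℝ | sobolevENormSq Ω t f ≤ E} := by
  refine isClosed_of_closure_subset fun f hf => ?_
  have hE' : ∀ q : Ω →ᵇ ℝ, sobolevENormSq Ω t q ≤ E → sobolevENormSq Ω t q ≠ ⊤ :=
    fun q hq => ne_top_of_le_ne_top hE hq
  -- The factor `8⁻¹` cancels the `8` of `exists_seq_tendsto_quadratic_cauchy`.
  let η : ℕ → ℝ≥0∞ := fun N => 8⁻¹ * (2⁻¹ ^ (N + 1)) ^ 2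
  obtain ⟨q, hqf, hqE, hqc⟩ := exists_seq_tendsto_quadratic_cauchy
    (fun q : Ω →ᵇ ℝ => sobolevENormSq Ω t q) (fun f h hf hh => by
      have := sobolevENormSq_convex_identity hΩ hf hh (c := 1 / 2) (d := 1 / 2)
        (by norm_num) (by norm_num) (by norm_num)
      have e1 : ENNReal.ofReal (1 / 2) = 2⁻¹ := by
        rw [one_div, ENNReal.ofReal_inv_of_pos two_pos]; simp
      have e2 : ENNReal.ofReal (1 / 2 * (1 / 2)) = 4⁻¹ := by
        rw [show (1 / 2 * (1 / 2) : ℝ) = 4⁻¹ by norm_num, ENNReal.ofReal_inv_of_pos four_pos]; simp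
      rw [e1, e2] at this
      exact this) hE hf (η := η)
    (fun N M h => by
      refine mul_le_mul_right (pow_le_pow_left' ?_ 2) _
      exact pow_le_pow_of_le_one zero_le (by norm_num) (by omega))
    (fun N => by simp [η])
  have hη : ∀ N, 8 * η N = (2⁻¹ ^ (N + 1)) ^ 2 := fun N => by
    simp only [η]
    rw [← mul_assoc, ENNReal.mul_inv_cancel (by norm_num) (by norm_num), one_mul]
  have w := fun n => hasWeakDeriv_of_sobolevENormSq_ne_top (hE' _ (hqE n))
  have hlim : ∀ k, ∃ G : Ω → ℝ, k ≤ ⌊t⌋₊ → Measurable G ∧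
      (∀ᵐ x ∂(lebesgueOn Ω), Tendsto (fun n => weakDeriv Ω k (q n) x) atTop (𝓝 (G x))) ∧
      Tendsto (fun n => eLpNorm (weakDeriv Ω k (q n) - G) 2 (lebesgueOn Ω)) atTop (𝓝 0) := by
    intro k
    by_cases hk : k ≤ ⌊t⌋₊
    · have hc : ∀ N n m, N ≤ n → N ≤ m → ∫⁻ x, ENNReal.ofReal
          ((weakDeriv Ω k (q n) x - weakDeriv Ω k (q m) x) ^ 2) ∂(lebesgueOn Ω) ≤
          (2⁻¹ ^ (N + 1)) ^ 2 := by
        intro N n m hn hm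
        refine le_trans ?_ ((hqc N n m hn hm).trans (hη N).le)
        have ws : ∀ k ≤ ⌊t⌋₊, HasWeakDeriv Ω k (q n - q m : Ω →ᵇ ℝ)
            (fun x => weakDeriv Ω k (q n) x - weakDeriv Ω k (q m) x) := fun k hk => by
          have e := (w n k hk).linear_comb (w m k hk) 1 (-1)
          simp only [one_mul, neg_one_mul, ← sub_eq_add_neg] at e
          exact e
        rw [sobolevENormSq_eq_sobolevForm hΩ ws]
        exact lintegral_sq_le_sobolevForm
          (fun k x => weakDeriv Ω k (q n) x - weakDeriv Ω k (q m) x) hk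
      obtain ⟨G, hG⟩ := exists_ae_limit_of_lintegral_sq_cauchy
        (fun n => (w n k hk).aemeasurable) hc
      exact ⟨G, fun _ => hG⟩
    · exact ⟨0, fun h => absurd h hk⟩
  choose G hG using hlim
  have hform : sobolevForm Ω t G ≤ E := by
    refine (sobolevForm_le_liminf (fun n k hk => (w n k hk).aemeasurable)
      fun k hk => (hG k hk).2.1).trans ?_
    refine liminf_le_of_le (by isBoundedDefault) fun c hc => ?_
    obtain ⟨n, hn⟩ := hc.exists
    refine hn.trans ?_
    rw [← sobolevENormSq_eq_sobolevForm hΩ (w n)]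
    exact hqE n
  have hGi : ∀ k ≤ ⌊t⌋₊, Integrable (G k) (lebesgueOn Ω) := fun k hk => by
    refine MemLp.integrable one_le_two ⟨(hG k hk).1.aestronglyMeasurable, ?_⟩
    rw [eLpNorm_two_eq_lintegral_ofReal_sq]
    exact ENNReal.rpow_lt_top_of_nonneg (by norm_num)
      (ne_top_of_le_ne_top hE ((lintegral_sq_le_sobolevForm G hk).trans hform))
  have wf : ∀ k ≤ ⌊t⌋₊, HasWeakDeriv Ω k f (G k) := fun k hk =>
    HasWeakDeriv.of_tendsto hqf (fun n => w n k hk) (hGi k hk) (hG k hk).2.2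
  change sobolevENormSq Ω t f ≤ E
  rw [sobolevENormSq_eq_sobolevForm hΩ wf]
  exact hform

/-! ### Compactness of the model -/

/-- A version of the Arzelà–Ascoli theorem on totally bounded spaces. -/
theorem isCompact_of_uniform_equicontinuous {X : Type*} [PseudoMetricSpace X]
    (hX : TotallyBounded (Set.univ : Set X)) {S : Set (X →ᵇ ℝ)} (hS : IsClosed S) {M : ℝ}
    (hM : ∀ p ∈ S, ∀ x, |p x| ≤ M)
    (hω : ∀ ε > 0, ∃ δ > 0, ∀ p ∈ S, ∀ x y, dist x y < δ → |p x - p y| ≤ ε) : IsCompact S := by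
  rw [isCompact_iff_ultrafilter_le_nhds]
  intro U hU
  have hUS : ∀ᶠ p in (U : Filter (X →ᵇ ℝ)), p ∈ S := hU (mem_principal_self S)
  -- An ultrafilter on `S` converges pointwise everywhere because the values lie in a compact
  -- interval. A finite net and equicontinuity make the convergence uniform.
  have hlim : ∀ x, ∃ y ∈ Set.Icc (-M) M, Tendsto (fun p : X →ᵇ ℝ => p x) U (𝓝 y) := by
    intro x
    refine isCompact_Icc.ultrafilter_le_nhds (U.map fun p : X →ᵇ ℝ => p x) ?_
    rw [le_principal_iff]
    exact hUS.mono fun p hp => abs_le.1 (hM p hp x)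
  choose F hFM hF using hlim
  have hFω : ∀ ε > 0, ∃ δ > 0, (∀ p ∈ S, ∀ x y, dist x y < δ → |p x - p y| ≤ ε) ∧
      ∀ x y, dist x y < δ → |F x - F y| ≤ ε := by
    intro ε hε
    obtain ⟨δ, hδ, H⟩ := hω ε hε
    refine ⟨δ, hδ, H, fun x y hxy => ?_⟩
    exact le_of_tendsto ((hF x).sub (hF y)).abs (hUS.mono fun p hp => H p hp x y hxy)
  have hFc : Continuous F := by
    rw [Metric.continuous_iff]
    intro x ε hε
    obtain ⟨δ, hδ, -, H⟩ := hFω (ε / 2) (half_pos hε)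
    exact ⟨δ, hδ, fun y hy => (H y x hy).trans_lt (half_lt_self hε)⟩
  let f : X →ᵇ ℝ := BoundedContinuousFunction.ofNormedAddCommGroup F hFc M
    fun x => abs_le.2 (hFM x)
  have hUf : (U : Filter (X →ᵇ ℝ)) ≤ 𝓝 f := by
    have : Tendsto (fun p : X →ᵇ ℝ => p) U (𝓝 f) := by
      rw [Metric.tendsto_nhds]
      intro ε hε
      obtain ⟨δ, hδ, H, HF⟩ := hFω (ε / 4) (by positivity)
      obtain ⟨T, hT, hcov⟩ := Metric.totallyBounded_iff.1 hX δ hδ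
      have hT' : ∀ᶠ p in (U : Filter (X →ᵇ ℝ)), ∀ y ∈ T, |p y - F y| < ε / 4 := by
        rw [eventually_all_finite hT]
        intro y _
        exact Metric.tendsto_nhds.1 (hF y) _ (by positivity)
      filter_upwards [hUS, hT'] with p hp hpT
      refine lt_of_le_of_lt ((BoundedContinuousFunction.dist_le (C := 3 * ε / 4)
        (by positivity)).2 fun x => ?_) (by linarith)
      obtain ⟨y, hy, hxy⟩ := Set.mem_iUnion₂.1 (hcov (Set.mem_univ x))
      have h1 := H p hp x y hxy
      have h2 := hpT y hy
      have h3 := HF x y hxy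
      change |p x - F x| ≤ 3 * ε / 4
      rw [abs_le] at *
      rw [abs_lt] at h2
      constructor <;> linarith [h1.1, h1.2, h2.1, h2.2, h3.1, h3.2]
    exact this
  exact ⟨f, hS.mem_of_tendsto hUf hUS, hUf⟩

/-- Square integrability is automatic for bounded functions on a bounded interval, and finiteness of
the norm follows from the bound `D`. -/
theorem mem_densityModel_iff {a b t ζ D : ℝ} (hD : 0 ≤ D) {p : Set.Ioo a b →ᵇ ℝ} :
    p ∈ densityModel (Set.Ioo a b) t ζ D ↔
      sobolevENormSq (Set.Ioo a b) t p ≤ ENNReal.ofReal (D ^ 2) ∧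
      ∫ x : Set.Ioo a b, p x ∂(lebesgueOn (Set.Ioo a b)) = 1 ∧ ∀ x, ζ ≤ p x := by
  rw [← sobolevENorm_le_ofReal_iff hD]
  constructor
  · rintro ⟨-, h1, h2, h3⟩
    exact ⟨h3, h1, h2⟩
  · rintro ⟨h3, h1, h2⟩
    refine ⟨⟨MemLp.of_bound p.continuous.aestronglyMeasurable ‖p‖
      (Eventually.of_forall p.norm_coe_le_norm), h3.trans_lt ENNReal.ofReal_lt_top⟩, h1, h2, h3⟩

theorem totallyBounded_univ_Ioo (a b : ℝ) : TotallyBounded (Set.univ : Set (Set.Ioo a b)) := by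
  rw [← totallyBounded_image_iff isUniformEmbedding_subtype_val.isUniformInducing]
  rw [Set.image_univ, Subtype.range_coe]
  exact totallyBounded_Ioo a b

theorem isClosed_densityModel {a b t ζ D : ℝ} (hD : 0 ≤ D) :
    IsClosed (densityModel (Set.Ioo a b) t ζ D) := by
  have e : densityModel (Set.Ioo a b) t ζ D =
      {p : Set.Ioo a b →ᵇ ℝ | sobolevENormSq (Set.Ioo a b) t p ≤ ENNReal.ofReal (D ^ 2)} ∩
      ({p | ∫ x : Set.Ioo a b, p x ∂(lebesgueOn (Set.Ioo a b)) = 1} ∩ {p | ∀ x, ζ ≤ p x}) := by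
    ext p; exact mem_densityModel_iff hD
  rw [e]
  refine (isClosed_sobolevENormSq_le isOpen_Ioo t ENNReal.ofReal_ne_top).inter (IsClosed.inter ?_ ?_)
  · refine isClosed_eq ?_ continuous_const
    rw [continuous_iff_continuousAt]
    intro p
    refine tendsto_integral_filter_of_dominated_convergence (fun _ => ‖p‖ + 1)
      (Eventually.of_forall fun q => q.continuous.aestronglyMeasurable) ?_ (integrable_const _) ?_
    · filter_upwards [continuous_norm.continuousAt.eventually (gt_mem_nhds (lt_add_one ‖p‖))]
        with q hq
      exact Eventually.of_forall fun x => (q.norm_coe_le_norm x).trans hq.le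
    · exact Eventually.of_forall fun x =>
        (BoundedContinuousFunction.evalCLM ℝ x).continuous.tendsto p
  · rw [Set.ofPred_forall]
    exact isClosed_iInter fun x =>
      isClosed_le continuous_const (BoundedContinuousFunction.evalCLM ℝ x).continuous

theorem isCompact_densityModel {a b t ζ D : ℝ} (hab : a < b) (ht : 1 / 2 < t) (hζ : 0 ≤ ζ)
    (hD : 0 ≤ D) : IsCompact (densityModel (Set.Ioo a b) t ζ D) := by
  obtain ⟨C, σ, hC, hσ, H⟩ := exists_holder_bound_of_sobolevENormSq_le a b ht D
  refine isCompact_of_uniform_equicontinuous (totallyBounded_univ_Ioo a b)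
    (isClosed_densityModel hD) (M := (b - a)⁻¹ + C * (b - a) ^ σ) ?_ ?_
  · intro p hp x
    rw [mem_densityModel_iff hD] at hp
    rw [abs_of_nonneg (hζ.trans (hp.2.2 x))]
    -- The Hölder bound keeps `p` above `p x - C (b - a) ^ σ` everywhere; total mass `1` then limits
    -- `p x`.
    have h1 : ∀ y : Set.Ioo a b, p x - C * (b - a) ^ σ ≤ p y := fun y => by
      have h2 : |(x : ℝ) - y| ^ σ ≤ (b - a) ^ σ := by
        refine Real.rpow_le_rpow (abs_nonneg _) ?_ hσ.le
        rw [abs_le]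
        constructor <;> linarith [x.2.1, x.2.2, y.2.1, y.2.2]
      have := (le_abs_self _).trans (H p hp.1 x y)
      have := mul_le_mul_of_nonneg_left h2 hC
      linarith
    have h2 := integral_mono (integrable_const _) (p.integrable (lebesgueOn (Set.Ioo a b))) h1
    rw [integral_const, measureReal_lebesgueOn_Ioo_univ hab, hp.2.1, smul_eq_mul, mul_comm] at h2
    have := (le_div_iff₀ (sub_pos.2 hab)).2 h2
    rw [one_div] at this
    linarith
  · intro ε hε
    have hcont : Tendsto (fun r : ℝ => C * r ^ σ) (𝓝 0) (𝓝 0) := by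
      have := (Real.continuousAt_rpow_const 0 σ (Or.inr hσ.le)).tendsto.const_mul C
      simpa [Real.zero_rpow hσ.ne'] using this
    obtain ⟨δ, hδ, hδ'⟩ := Metric.tendsto_nhds_nhds.1 hcont ε hε
    refine ⟨δ, hδ, fun p hp x y hxy => ?_⟩
    rw [mem_densityModel_iff hD] at hp
    refine (H p hp.1 x y).trans ?_
    have := hδ' (x := |(x : ℝ) - y|) (by
      rw [Real.dist_eq, sub_zero, abs_abs]; exact hxy)
    rw [Real.dist_eq, sub_zero] at this
    exact (le_abs_self _).trans this.le

/-! ### Mixtures and bump densities -/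

instance isOpenPosMeasure_lebesgueOn_Ioo (a b : ℝ) :
    (lebesgueOn (Set.Ioo a b)).IsOpenPosMeasure :=
  Measure.IsOpenPosMeasure.comap volume isOpen_Ioo.isOpenEmbedding_subtypeVal

theorem exists_bcf_eq_of_continuous (a b : ℝ) {G : ℝ → ℝ} (hG : Continuous G) :
    ∃ g : Set.Ioo a b →ᵇ ℝ, ∀ x, g x = G x := by
  obtain ⟨C, hC⟩ := isCompact_Icc.exists_bound_of_continuousOn (s := Set.Icc a b) hG.continuousOn
  exact ⟨BoundedContinuousFunction.ofNormedAddCommGroup (fun x : Set.Ioo a b => G x)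
    (hG.comp continuous_subtype_val) C fun x => hC x (Set.Ioo_subset_Icc_self x.2), fun _ => rfl⟩

theorem const_mem_densityModel {a b t ζ D : ℝ} (hab : a < b) (hD : 0 ≤ D)
    (hζb : ζ < (b - a)⁻¹) (hbD : (b - a)⁻¹ < D ^ 2) :
    BoundedContinuousFunction.const (Set.Ioo a b) (b - a)⁻¹ ∈
      densityModel (Set.Ioo a b) t ζ D := by
  have h0 : b - a ≠ 0 := (sub_pos.2 hab).ne'
  refine (mem_densityModel_iff hD).2 ⟨?_, ?_, fun x => hζb.le⟩
  · have : sobolevENormSq (Set.Ioo a b) t (BoundedContinuousFunction.const (Set.Ioo a b) (b - a)⁻¹)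
        = ENNReal.ofReal (((b - a)⁻¹) ^ 2 * (b - a)) := sobolevENormSq_const a b t _
    rw [this]
    refine ENNReal.ofReal_le_ofReal ?_
    rw [pow_two, mul_assoc, inv_mul_cancel₀ h0, mul_one]
    exact hbD.le
  · simp only [BoundedContinuousFunction.const_apply, integral_const,
      measureReal_lebesgueOn_Ioo_univ hab, smul_eq_mul]
    exact mul_inv_cancel₀ h0

/-- The floor `ζ` leaves mass `κ > 0`, which is spent on narrow bumps at the data points. Only
finiteness of the norm is claimed, since the density is used in small proportions. -/
theorem exists_density_gt {a b : ℝ} (hab : a < b) (t : ℝ) {ζ : ℝ} (hζ : 0 ≤ ζ)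
    (hζb : ζ < (b - a)⁻¹) {n : ℕ} (hn : 1 ≤ n) (x : Fin n → Set.Ioo a b) (B : ℝ) :
    ∃ g : Set.Ioo a b →ᵇ ℝ, ∫ z, g z ∂(lebesgueOn (Set.Ioo a b)) = 1 ∧ (∀ z, ζ ≤ g z) ∧
      sobolevENormSq (Set.Ioo a b) t g < ⊤ ∧ ∀ i, B < g (x i) := by
  have hba := sub_pos.2 hab
  set κ := 1 - ζ * (b - a) with hκ
  have hκ0 : 0 < κ := by
    have := mul_lt_mul_of_pos_right hζb hba
    rw [inv_mul_cancel₀ hba.ne'] at this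
    linarith
  have hn0 : (0 : ℝ) < n := by exact_mod_cast hn
  -- The bumps have total mass at most `2nr = κ / (2(|B| + 1))`, so rescaling it to `κ` multiplies
  -- their height by at least `2(|B| + 1)`.
  set r := κ / (4 * n * (|B| + 1)) with hr
  have hr0 : 0 < r := by positivity
  let β : ∀ i, ContDiffBump ((x i : ℝ)) := fun i => ⟨r / 2, r, by positivity, by linarith⟩
  set G : ℝ → ℝ := fun z => ∑ i, β i z with hG
  have hGs : ContDiff ℝ ∞ G := ContDiff.sum fun i _ => (β i).contDiff
  have hG0 : ∀ z, 0 ≤ G z := fun z => Finset.sum_nonneg fun i _ => (β i).nonneg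
  have hG1 : ∀ i, 1 ≤ G (x i) := fun i => by
    have h1 : β i (x i) = 1 := (β i).one_of_mem_closedBall (Metric.mem_closedBall_self (by
      change 0 ≤ r / 2; positivity))
    rw [← h1]
    exact Finset.single_le_sum (f := fun j => β j (x i)) (fun j _ => (β j).nonneg)
      (Finset.mem_univ i)
  have hGint : Integrable (fun z : Set.Ioo a b => G z) (lebesgueOn (Set.Ioo a b)) := by
    obtain ⟨g, hg⟩ := exists_bcf_eq_of_continuous a b hGs.continuous
    simpa only [← hg] using g.integrable (lebesgueOn (Set.Ioo a b))
  set m := ∫ z : Set.Ioo a b, G z ∂(lebesgueOn (Set.Ioo a b)) with hm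
  have hm0 : 0 < m := by
    rw [hm, integral_pos_iff_support_of_nonneg (f := fun z : Set.Ioo a b => G z) (fun z => hG0 z) hGint]
    have ho : IsOpen (Function.support fun z : Set.Ioo a b => G z) :=
      (hGs.continuous.comp continuous_subtype_val).isOpen_support
    refine ho.measure_pos _ ⟨x ⟨0, hn⟩, ?_⟩
    exact (lt_of_lt_of_le one_pos (hG1 ⟨0, hn⟩)).ne'
  have hmr : m ≤ 2 * n * r := by
    have hint : ∀ i, Integrable (β i) := fun i =>
      (β i).continuous.integrable_of_hasCompactSupport (β i).hasCompactSupport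
    calc m = ∫ z in Set.Ioo a b, G z := integral_subtype_comap measurableSet_Ioo G
      _ ≤ ∫ z, G z := setIntegral_le_integral (integrable_finsetSum _ fun i _ => hint i)
          (Eventually.of_forall hG0)
      _ = ∑ i, ∫ z, β i z := integral_finsetSum _ fun i _ => hint i
      _ ≤ ∑ i : Fin n, 2 * r := by
          refine Finset.sum_le_sum fun i _ => ((β i).integral_le_measure_closedBall volume).trans ?_
          rw [Real.volume_real_closedBall (by change 0 ≤ r; positivity)]
      _ = 2 * n * r := by simp; ring
  obtain ⟨g, hg⟩ := exists_bcf_eq_of_continuous a b (G := fun z => ζ + κ / m * G z)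
    (continuous_const.add (continuous_const.mul hGs.continuous))
  have hsm : ContDiff ℝ ∞ (fun z => ζ + κ / m * G z) :=
    contDiff_const.add (contDiff_const.mul hGs)
  refine ⟨g, ?_, fun z => ?_, ?_, fun i => ?_⟩
  · simp only [hg]
    rw [integral_add (integrable_const _) (hGint.const_mul _), integral_const, integral_const_mul,
      measureReal_lebesgueOn_Ioo_univ hab, ← hm, div_mul_cancel₀ _ hm0.ne', smul_eq_mul, hκ]
    ring
  · rw [hg]
    have := mul_nonneg (div_pos hκ0 hm0).le (hG0 z)
    linarith
  · rw [show (g : Set.Ioo a b → ℝ) = fun z : Set.Ioo a b => ζ + κ / m * G z from funext hg]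
    exact sobolevENormSq_lt_top_of_contDiff hsm
  · rw [hg]
    have h1 : 2 * (|B| + 1) ≤ κ / m := by
      rw [le_div_iff₀ hm0]
      calc _ ≤ 2 * (|B| + 1) * (2 * n * r) := by gcongr
        _ = κ := by rw [hr]; field_simp; ring
    have h2 : κ / m * 1 ≤ κ / m * G (x i) :=
      mul_le_mul_of_nonneg_left (hG1 i) (div_pos hκ0 hm0).le
    have h3 := le_abs_self B
    have h4 := abs_nonneg B
    linarith

theorem integral_mixture_eq_one {a b : ℝ} {p q : Set.Ioo a b →ᵇ ℝ}
    (hp : ∫ x, p x ∂(lebesgueOn (Set.Ioo a b)) = 1)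
    (hq : ∫ x, q x ∂(lebesgueOn (Set.Ioo a b)) = 1) {c d : ℝ} (hcd : c + d = 1) :
    ∫ x, (c • p + d • q) x ∂(lebesgueOn (Set.Ioo a b)) = 1 := by
  simp only [BoundedContinuousFunction.coe_add, BoundedContinuousFunction.coe_smul, Pi.add_apply,
    smul_eq_mul]
  rw [integral_add ((p.integrable _).const_mul _) ((q.integrable _).const_mul _),
    integral_const_mul, integral_const_mul, hp, hq]
  linarith

theorem sobolevENormSq_mixture {a b t : ℝ} {p q : Set.Ioo a b →ᵇ ℝ}
    (hp : sobolevENormSq (Set.Ioo a b) t p ≠ ⊤) (hq : sobolevENormSq (Set.Ioo a b) t q ≠ ⊤)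
    {c d : ℝ} (hc : 0 ≤ c) (hd : 0 ≤ d) (hcd : c + d = 1) :
    sobolevENormSq (Set.Ioo a b) t (c • p + d • q : Set.Ioo a b →ᵇ ℝ) +
      ENNReal.ofReal (c * d) * sobolevENormSq (Set.Ioo a b) t (p - q : Set.Ioo a b →ᵇ ℝ) =
    ENNReal.ofReal c * sobolevENormSq (Set.Ioo a b) t p +
      ENNReal.ofReal d * sobolevENormSq (Set.Ioo a b) t q :=
  sobolevENormSq_convex_identity isOpen_Ioo hp hq hc hd hcd

/-- The term of order zero is the `L²` norm, and a continuous function vanishing almost everywhere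
is zero. -/
theorem sobolevENormSq_pos_of_ne_zero {a b t : ℝ} {p : Set.Ioo a b →ᵇ ℝ} (hp : p ≠ 0) :
    0 < sobolevENormSq (Set.Ioo a b) t p := by
  rw [pos_iff_ne_zero]
  intro h
  refine hp ?_
  have w := hasWeakDeriv_of_sobolevENormSq_ne_top (h ▸ ENNReal.zero_ne_top)
  rw [sobolevENormSq_eq_sobolevForm isOpen_Ioo w] at h
  have h1 := lintegral_sq_le_sobolevForm (Ω := Set.Ioo a b) (s := t)
    (fun k => weakDeriv (Set.Ioo a b) k p) (Nat.zero_le _)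
  rw [h, nonpos_iff_eq_zero, lintegral_eq_zero_iff'
    (((w 0 (Nat.zero_le _)).aemeasurable.pow_const 2).ennreal_ofReal)] at h1
  have h2 := (hasWeakDeriv_zero (p.integrable (lebesgueOn (Set.Ioo a b))).locallyIntegrable
    ).weakDeriv_ae_eq isOpen_Ioo
  have h3 : (p : Set.Ioo a b → ℝ) =ᵐ[lebesgueOn (Set.Ioo a b)] (fun _ => 0) := by
    filter_upwards [h1, h2] with x hx1 hx2
    rw [hx2] at hx1
    have := ENNReal.ofReal_eq_zero.1 hx1
    exact pow_eq_zero_iff two_ne_zero |>.1 (le_antisymm this (sq_nonneg _))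
  have h4 := (Continuous.ae_eq_iff_eq _ p.continuous continuous_const).1 h3
  ext x
  exact congrFun h4 x

/-! ### Maximizers of the likelihood -/

/-- `p` maximizes the likelihood `∏ p(x i)` over the model. -/
def IsLikelihoodMax {a b : ℝ} (t ζ D : ℝ) {n : ℕ} (x : Fin n → Set.Ioo a b)
    (p : Set.Ioo a b →ᵇ ℝ) : Prop :=
  p ∈ densityModel (Set.Ioo a b) t ζ D ∧
    ∀ q ∈ densityModel (Set.Ioo a b) t ζ D, ∏ i, q (x i) ≤ ∏ i, p (x i)

theorem sum_ennreal_log {n : ℕ} (u : Fin n → ℝ≥0∞) :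
    ∑ i, ENNReal.log (u i) = ENNReal.log (∏ i, u i) := by
  induction n with
  | zero => simp
  | succ n ih => rw [Fin.sum_univ_succ, Fin.prod_univ_succ, ih, ENNReal.log_mul_add]

theorem logLik_le_logLik_iff {Ω : Set ℝ} {n : ℕ} (hn : 1 ≤ n) {p q : Ω → ℝ}
    (hp : ∀ x, 0 ≤ p x) (hq : ∀ x, 0 ≤ q x) (x : Fin n → Ω) :
    logLik p x ≤ logLik q x ↔ ∏ i, p (x i) ≤ ∏ i, q (x i) := by
  have hn0 : (0 : ℝ) < n := by exact_mod_cast hn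
  -- Multiplication by `n` undoes the normalization in the extended reals, even at the value `-∞`.
  have hc : (((n : ℝ) : EReal)) * ((1 / (n : ℝ) : ℝ) : EReal) = 1 := by
    rw [← EReal.coe_mul, mul_one_div_cancel hn0.ne', EReal.coe_one]
  unfold logLik
  rw [sum_ennreal_log, sum_ennreal_log, ← ENNReal.ofReal_prod_of_nonneg fun i _ => hp _,
    ← ENNReal.ofReal_prod_of_nonneg fun i _ => hq _,
    ← ENNReal.ofReal_le_ofReal_iff (Finset.prod_nonneg fun i _ => hq _), ← ENNReal.log_le_log_iff]
  constructor
  · intro h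
    have h1 := mul_le_mul_of_nonneg_left h (EReal.coe_nonneg.2 hn0.le)
    rwa [← mul_assoc, ← mul_assoc, hc, one_mul, one_mul] at h1
  · intro h
    exact mul_le_mul_of_nonneg_left h (EReal.coe_nonneg.2 (by positivity))

theorem logLik_eq_iSup_iff {a b t ζ D : ℝ} (hζ : 0 ≤ ζ) {n : ℕ} (hn : 1 ≤ n)
    (x : Fin n → Set.Ioo a b) (p : densityModel (Set.Ioo a b) t ζ D) :
    (logLik p.1 x = ⨆ q : densityModel (Set.Ioo a b) t ζ D, logLik q.1 x) ↔
      IsLikelihoodMax t ζ D x p.1 := by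
  have h0 : ∀ q : densityModel (Set.Ioo a b) t ζ D, ∀ z, 0 ≤ q.1 z := fun q z =>
    hζ.trans (q.2.2.2.1 z)
  constructor
  · intro h
    refine ⟨p.2, fun q hq => ?_⟩
    rw [← logLik_le_logLik_iff hn (h0 ⟨q, hq⟩) (h0 p), h]
    exact le_iSup (fun q : densityModel (Set.Ioo a b) t ζ D => logLik q.1 x) ⟨q, hq⟩
  · intro h
    refine le_antisymm
      (le_iSup (fun q : densityModel (Set.Ioo a b) t ζ D => logLik q.1 x) p) (iSup_le fun q => ?_)
    exact (logLik_le_logLik_iff hn (h0 q) (h0 p) x).2 (h.2 q.1 q.2)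

section Maximizer

variable {a b t ζ D : ℝ} {n : ℕ}

theorem exists_isLikelihoodMax (hab : a < b) (ht : 1 / 2 < t) (hζ : 0 ≤ ζ) (hD : 0 ≤ D)
    (hζb : ζ < (b - a)⁻¹) (hbD : (b - a)⁻¹ < D ^ 2) (x : Fin n → Set.Ioo a b) :
    ∃ p, IsLikelihoodMax t ζ D x p := by
  have hc : Continuous fun p : Set.Ioo a b →ᵇ ℝ => ∏ i, p (x i) :=
    continuous_finsetProd _ fun i _ =>
      (BoundedContinuousFunction.evalCLM ℝ (x i)).continuous
  obtain ⟨p, hp, hmax⟩ := (isCompact_densityModel (t := t) (ζ := ζ) (D := D) hab ht hζ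
    hD).exists_isMaxOn ⟨_, const_mem_densityModel hab hD hζb hbD⟩ hc.continuousOn
  exact ⟨p, hp, fun q hq => hmax hq⟩

theorem IsLikelihoodMax.pos (hab : a < b) (hζ : 0 ≤ ζ) (hD : 0 ≤ D)
    (hζb : ζ < (b - a)⁻¹) (hbD : (b - a)⁻¹ < D ^ 2) {x : Fin n → Set.Ioo a b}
    {p : Set.Ioo a b →ᵇ ℝ} (h : IsLikelihoodMax t ζ D x p) (i : Fin n) : 0 < p (x i) := by
  have h1 := h.2 _ (const_mem_densityModel hab hD hζb hbD)
  have h2 : 0 < ∏ i, p (x i) := by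
    refine lt_of_lt_of_le (Finset.prod_pos fun i _ => ?_) h1
    exact inv_pos.2 (sub_pos.2 hab)
  exact lt_of_le_of_ne (hζ.trans (h.1.2.2.1 _)) (Finset.prod_ne_zero_iff.1 h2.ne' i
    (Finset.mem_univ i)).symm

/-- A maximizer lies on the boundary of the Sobolev ball: otherwise, mixing it with a little of a
density that is large at the data would increase the likelihood. -/
theorem IsLikelihoodMax.sobolevENormSq_eq (hab : a < b) (hζ : 0 ≤ ζ) (hD : 0 ≤ D)
    (hζb : ζ < (b - a)⁻¹) (hbD : (b - a)⁻¹ < D ^ 2) (hn : 1 ≤ n) {x : Fin n → Set.Ioo a b}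
    {p : Set.Ioo a b →ᵇ ℝ} (h : IsLikelihoodMax t ζ D x p) :
    sobolevENormSq (Set.Ioo a b) t p = ENNReal.ofReal (D ^ 2) := by
  obtain ⟨hN, hp1, hpζ⟩ := (mem_densityModel_iff hD).1 h.1
  by_contra hne
  have hlt := lt_of_le_of_ne hN hne
  -- At the data `g` exceeds the sup-norm of `p`, so every proper mixture is larger than `p` there.
  obtain ⟨g, hg1, hgζ, hgN, hgx⟩ := exists_density_gt hab t hζ hζb hn x ‖p‖
  have hlim : Tendsto (fun ε : ℝ => sobolevENormSq (Set.Ioo a b) t p +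
      ENNReal.ofReal ε * sobolevENormSq (Set.Ioo a b) t g) (𝓝[>] 0)
      (𝓝 (sobolevENormSq (Set.Ioo a b) t p)) := by
    have h1 : Tendsto (fun ε : ℝ => ENNReal.ofReal ε) (𝓝[>] 0) (𝓝 0) := by
      have := (ENNReal.continuous_ofReal.tendsto 0).mono_left
        (nhdsWithin_le_nhds (s := Set.Ioi (0 : ℝ)))
      simpa using this
    have h2 := (ENNReal.Tendsto.mul_const h1 (Or.inr hgN.ne)).const_add
      (sobolevENormSq (Set.Ioo a b) t p)
    simpa using h2
  have hev : ∀ᶠ ε : ℝ in 𝓝[>] 0, 0 < ε ∧ ε < 1 ∧ sobolevENormSq (Set.Ioo a b) t p +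
      ENNReal.ofReal ε * sobolevENormSq (Set.Ioo a b) t g < ENNReal.ofReal (D ^ 2) := by
    filter_upwards [self_mem_nhdsWithin, nhdsWithin_le_nhds (gt_mem_nhds one_pos),
      hlim.eventually (gt_mem_nhds hlt)] with ε h1 h2 h3
    exact ⟨h1, h2, h3⟩
  obtain ⟨ε, hε0, hε1, hε⟩ := hev.exists
  have hmem : (1 - ε) • p + ε • g ∈ densityModel (Set.Ioo a b) t ζ D := by
    refine (mem_densityModel_iff hD).2 ⟨?_, integral_mixture_eq_one hp1 hg1 (by ring), fun z => ?_⟩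
    · have id1 := sobolevENormSq_mixture hlt.ne_top hgN.ne (c := 1 - ε) (d := ε) (by linarith)
        hε0.le (by ring)
      refine le_trans (le_self_add.trans id1.le) (le_trans ?_ hε.le)
      gcongr
      calc _ ≤ 1 * sobolevENormSq (Set.Ioo a b) t p := by
            gcongr
            rw [← ENNReal.ofReal_one]
            exact ENNReal.ofReal_le_ofReal (by linarith)
        _ = _ := one_mul _
    · have h1 := mul_le_mul_of_nonneg_left (hpζ z) (by linarith : 0 ≤ 1 - ε)
      have h2 := mul_le_mul_of_nonneg_left (hgζ z) hε0.le
      change ζ ≤ (1 - ε) * p z + ε * g z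
      linarith
  have hcontra : ∏ i, p (x i) < ∏ i, ((1 - ε) • p + ε • g) (x i) := by
    have : Nonempty (Fin n) := ⟨⟨0, hn⟩⟩
    refine Finset.prod_lt_prod_of_nonempty (fun i _ => h.pos hab hζ hD hζb hbD i)
      (fun i _ => ?_) Finset.univ_nonempty
    have h1 : p (x i) < g (x i) :=
      ((le_abs_self _).trans (p.norm_coe_le_norm (x i))).trans_lt (hgx i)
    have h2 := mul_lt_mul_of_pos_left h1 hε0
    change p (x i) < (1 - ε) * p (x i) + ε * g (x i)
    linarith
  exact absurd (h.2 _ hmem) (not_le.2 hcontra)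

theorem IsLikelihoodMax.unique (hab : a < b) (hζ : 0 ≤ ζ) (hD : 0 ≤ D)
    (hζb : ζ < (b - a)⁻¹) (hbD : (b - a)⁻¹ < D ^ 2) (hn : 1 ≤ n) {x : Fin n → Set.Ioo a b}
    {p q : Set.Ioo a b →ᵇ ℝ} (hp : IsLikelihoodMax t ζ D x p) (hq : IsLikelihoodMax t ζ D x q) :
    p = q := by
  by_contra hne
  obtain ⟨hpN, hp1, hpζ⟩ := (mem_densityModel_iff hD).1 hp.1
  obtain ⟨hqN, hq1, hqζ⟩ := (mem_densityModel_iff hD).1 hq.1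
  have hpE := hp.sobolevENormSq_eq hab hζ hD hζb hbD hn
  have hqE := hq.sobolevENormSq_eq hab hζ hD hζb hbD hn
  have id1 := sobolevENormSq_mixture (ne_top_of_le_ne_top ENNReal.ofReal_ne_top hpN)
    (ne_top_of_le_ne_top ENNReal.ofReal_ne_top hqN) (c := 1 / 2) (d := 1 / 2) (by norm_num)
    (by norm_num) (by norm_num)
  rw [hpE, hqE, ← add_mul, ← ENNReal.ofReal_add (by norm_num) (by norm_num), add_halves,
    ENNReal.ofReal_one, one_mul] at id1
  set r : Set.Ioo a b →ᵇ ℝ := (1 / 2 : ℝ) • p + (1 / 2 : ℝ) • q with hr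
  have hrx : ∀ z, r z = 1 / 2 * p z + 1 / 2 * q z := fun z => rfl
  have hrN : sobolevENormSq (Set.Ioo a b) t r ≤ ENNReal.ofReal (D ^ 2) := le_self_add.trans id1.le
  have hrmem : r ∈ densityModel (Set.Ioo a b) t ζ D := by
    refine (mem_densityModel_iff hD).2 ⟨hrN, integral_mixture_eq_one hp1 hq1 (by norm_num),
      fun z => ?_⟩
    rw [hrx]
    linarith [hpζ z, hqζ z]
  have hpq : ∏ i, p (x i) = ∏ i, q (x i) := le_antisymm (hq.2 p hp.1) (hp.2 q hq.1)
  -- Since both likelihoods are equal, the square of one is `∏ p q`, and `p q ≤ ((p + q) / 2)²` at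
  -- each data point.
  have hprod : ∏ i, p (x i) ≤ ∏ i, r (x i) := by
    refine le_of_sq_le_sq ?_ (Finset.prod_nonneg fun i _ => hζ.trans (hrmem.2.2.1 _))
    calc (∏ i, p (x i)) ^ 2 = ∏ i, (p (x i) * q (x i)) := by
          rw [Finset.prod_mul_distrib, ← hpq, sq]
      _ ≤ ∏ i, (r (x i)) ^ 2 := by
          refine Finset.prod_le_prod
            (fun i _ => mul_nonneg (hζ.trans (hpζ _)) (hζ.trans (hqζ _))) fun i _ => ?_
          rw [hrx]
          have := sq_nonneg (p (x i) - q (x i))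
          linarith [this]
      _ = _ := Finset.prod_pow _ _ _
  have hrmax : IsLikelihoodMax t ζ D x r := ⟨hrmem, fun s hs => (hp.2 s hs).trans hprod⟩
  -- The midpoint also lies on the sphere, so the parallelogram identity leaves no room for `p - q`.
  rw [hrmax.sobolevENormSq_eq hab hζ hD hζb hbD hn] at id1
  have h0 : ENNReal.ofReal (1 / 2 * (1 / 2)) *
      sobolevENormSq (Set.Ioo a b) t (p - q : Set.Ioo a b →ᵇ ℝ) = 0 :=
    (ENNReal.add_right_inj ENNReal.ofReal_ne_top).1 (id1.trans (add_zero _).symm)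
  rcases mul_eq_zero.1 h0 with h | h
  · rw [ENNReal.ofReal_eq_zero] at h
    norm_num at h
  · exact (sobolevENormSq_pos_of_ne_zero (sub_ne_zero.2 hne)).ne' h

/-- By compactness the maximizers converge along any ultrafilter tending to `x`. Joint continuity of
evaluation makes the limit a maximizer at `x`, and uniqueness identifies it with `F x`. -/
theorem continuous_of_isLikelihoodMax (hab : a < b) (ht : 1 / 2 < t) (hζ : 0 ≤ ζ) (hD : 0 ≤ D)
    (hζb : ζ < (b - a)⁻¹) (hbD : (b - a)⁻¹ < D ^ 2) (hn : 1 ≤ n)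
    {F : (Fin n → Set.Ioo a b) → (Set.Ioo a b →ᵇ ℝ)} (hF : ∀ x, IsLikelihoodMax t ζ D x (F x)) :
    Continuous F := by
  rw [continuous_iff_ultrafilter]
  intro x U hU
  obtain ⟨p, hp, hUp⟩ := isCompact_iff_ultrafilter_le_nhds.1
    (isCompact_densityModel (t := t) (ζ := ζ) (D := D) hab ht hζ hD) (U.map F)
    (tendsto_principal.2 (Eventually.of_forall fun y => (hF y).1))
  have hlim : Tendsto F (U : Filter (Fin n → Set.Ioo a b)) (𝓝 p) := hUp
  have hx : ∀ i, Tendsto (fun y : Fin n → Set.Ioo a b => y i) U (𝓝 (x i)) := fun i =>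
    ((continuous_apply i).tendsto x).mono_left hU
  have hmax : IsLikelihoodMax t ζ D x p := by
    refine ⟨hp, fun q hq => ?_⟩
    have l1 : Tendsto (fun y : Fin n → Set.Ioo a b => ∏ i, q (y i)) U (𝓝 (∏ i, q (x i))) :=
      tendsto_finsetProd _ fun i _ => (q.continuous.tendsto _).comp (hx i)
    have l2 : Tendsto (fun y : Fin n → Set.Ioo a b => ∏ i, F y (y i)) U (𝓝 (∏ i, p (x i))) :=
      tendsto_finsetProd _ fun i _ =>
        ((continuous_eval (F := Set.Ioo a b →ᵇ ℝ)).tendsto (p, x i)).comp (hlim.prodMk_nhds (hx i))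
    exact le_of_tendsto_of_tendsto' l1 l2 fun y => (hF y).2 q hq
  rw [(hF x).unique hab hζ hD hζb hbD hn hmax]
  exact hlim

end Maximizer

/-! ### The theorem on both estimators. -/

theorem mainTheorem5 (a b t ζ D : ℝ) (hab : a < b) (ht : 1 / 2 < t) (hζ : 0 ≤ ζ) (hD : 0 < D)
    (hζb : ζ < (b - a)⁻¹) (hbD : (b - a)⁻¹ < D ^ 2) :
    -- the estimator based on the observed data
    (∀ n : ℕ, 1 ≤ n →
      (∀ x : Fin n → Set.Ioo a b, ∃! p : densityModel (Set.Ioo a b) t ζ D,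
        logLik p.1 x = ⨆ q : densityModel (Set.Ioo a b) t ζ D, logLik q.1 x) ∧
      ∀ phat : (Fin n → Set.Ioo a b) → densityModel (Set.Ioo a b) t ζ D,
        (∀ x, logLik (phat x).1 x = ⨆ q : densityModel (Set.Ioo a b) t ζ D, logLik q.1 x) →
        @Measurable (Fin n → Set.Ioo a b) (densityModel (Set.Ioo a b) t ζ D)
          MeasurableSpace.pi (borel _) phat ∧
        ∀ x, sobolevENorm (Set.Ioo a b) t (phat x).1 = ENNReal.ofReal D) ∧
    -- the estimators based on the simulated data
    (∀ (m : ℕ) (Θ : Set (EuclideanSpace ℝ (Fin m))), Θ.Nonempty → IsCompact Θ →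
      ∀ (V : Type*) [MeasurableSpace V] (ρ : V → Θ → Set.Ioo a b),
      (∀ θ, Measurable fun v => ρ v θ) →
      ∀ k : ℕ, 1 ≤ k →
      (∀ (θ : Θ) (v : Fin k → V), ∃! p : densityModel (Set.Ioo a b) t ζ D,
        simLogLik ρ θ p.1 v = ⨆ q : densityModel (Set.Ioo a b) t ζ D, simLogLik ρ θ q.1 v) ∧
      ∀ ptilde : Θ → (Fin k → V) → densityModel (Set.Ioo a b) t ζ D,
        (∀ θ v, simLogLik ρ θ (ptilde θ v).1 v =
          ⨆ q : densityModel (Set.Ioo a b) t ζ D, simLogLik ρ θ q.1 v) →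
        (∀ θ, @Measurable (Fin k → V) (densityModel (Set.Ioo a b) t ζ D)
          MeasurableSpace.pi (borel _) (ptilde θ)) ∧
        (∀ θ v, sobolevENorm (Set.Ioo a b) t (ptilde θ v).1 = ENNReal.ofReal D) ∧
        ((∀ v, Continuous (ρ v)) → ∀ v, Continuous fun θ => ptilde θ v)) := by
  have hex : ∀ n : ℕ, 1 ≤ n → ∀ x : Fin n → Set.Ioo a b,
      ∃! p : densityModel (Set.Ioo a b) t ζ D,
        logLik p.1 x = ⨆ q : densityModel (Set.Ioo a b) t ζ D, logLik q.1 x := by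
    intro n hn x
    obtain ⟨p, hp⟩ := exists_isLikelihoodMax (t := t) hab ht hζ hD.le hζb hbD x
    refine ⟨⟨p, hp.1⟩, (logLik_eq_iSup_iff hζ hn x ⟨p, hp.1⟩).2 hp, fun q hq => Subtype.ext ?_⟩
    exact ((logLik_eq_iSup_iff hζ hn x q).1 hq).unique hab hζ hD.le hζb hbD hn hp
  have hnorm : ∀ n : ℕ, 1 ≤ n → ∀ (x : Fin n → Set.Ioo a b)
      (p : densityModel (Set.Ioo a b) t ζ D),
      (logLik p.1 x = ⨆ q : densityModel (Set.Ioo a b) t ζ D, logLik q.1 x) →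
      sobolevENorm (Set.Ioo a b) t p.1 = ENNReal.ofReal D := by
    intro n hn x p hp
    have h := ((logLik_eq_iSup_iff hζ hn x p).1 hp).sobolevENormSq_eq hab hζ hD.le hζb hbD hn
    refine le_antisymm p.2.2.2.2 (not_lt.1 fun hlt => ?_)
    exact ((sobolevENorm_lt_ofReal_iff hD.le).1 hlt).ne h
  have hcont : ∀ n : ℕ, 1 ≤ n → ∀ phat : (Fin n → Set.Ioo a b) →
      densityModel (Set.Ioo a b) t ζ D,
      (∀ x, logLik (phat x).1 x = ⨆ q : densityModel (Set.Ioo a b) t ζ D, logLik q.1 x) →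
      Continuous phat := by
    intro n hn phat h
    exact continuous_induced_rng.2 (continuous_of_isLikelihoodMax (t := t) hab ht hζ hD.le hζb hbD
      hn fun x => (logLik_eq_iSup_iff hζ hn x (phat x)).1 (h x))
  have hmeas : ∀ n : ℕ, 1 ≤ n → ∀ phat : (Fin n → Set.Ioo a b) →
      densityModel (Set.Ioo a b) t ζ D,
      (∀ x, logLik (phat x).1 x = ⨆ q : densityModel (Set.Ioo a b) t ζ D, logLik q.1 x) →
      @Measurable (Fin n → Set.Ioo a b) (densityModel (Set.Ioo a b) t ζ D)
        MeasurableSpace.pi (borel _) phat := by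
    intro n hn phat h
    let _ : MeasurableSpace (densityModel (Set.Ioo a b) t ζ D) := borel _
    have _ : BorelSpace (densityModel (Set.Ioo a b) t ζ D) := ⟨rfl⟩
    -- The interval is second countable, so open subsets of the finite product are measurable for
    -- the product σ-algebra and continuity is enough.
    exact (hcont n hn phat h).measurable
  refine ⟨fun n hn => ⟨hex n hn, fun phat h => ⟨hmeas n hn phat h,
    fun x => hnorm n hn x _ (h x)⟩⟩, ?_⟩
  intro m Θ _ _ V _ ρ hρ k hk
  refine ⟨fun θ v => hex k hk fun i => ρ (v i) θ, fun ptilde h => ?_⟩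
  choose phat hphat using fun x => (hex k hk x).exists
  -- By uniqueness the simulated estimator is the ordinary one evaluated at the simulated data.
  have heq : ∀ θ v, ptilde θ v = phat fun i => ρ (v i) θ := fun θ v =>
    (hex k hk fun i => ρ (v i) θ).unique (h θ v) (hphat _)
  refine ⟨fun θ => ?_, fun θ v => hnorm k hk _ _ (h θ v), fun hc v => ?_⟩
  · rw [show ptilde θ = phat ∘ fun v i => ρ (v i) θ from funext (heq θ)]
    refine @Measurable.comp _ _ _ _ _ (borel _) _ _ (hmeas k hk phat hphat) ?_
    exact measurable_pi_lambda _ fun i => (hρ θ).comp (measurable_pi_apply i)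
  · simp only [heq]
    exact (hcont k hk phat hphat).comp (continuous_pi fun i => hc (v i))
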